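/- Let $\lambda>0$, $\beta>2$, $\sigma\in\mathbb R$ and let $s\ge 1$ be an integer. Base stations (BSs) are located at the points $X_1,X_2,\dots$ of a homogeneous Poisson point process $\Phi=\sum_i\delta_{X_i}$ on $\mathbb R^2$ with intensity $\lambda$. Let $H_{i,t}$ ($i\ge1$, $t\ge0$) be i.i.d. exponential random variables with mean $1$ (Rayleigh fading), and let $Y_1,Y_2,\dots$ be i.i.d. random vectors in $\mathbb R^2$ with an arbitrary common law; the three families $(X_i)$, $(H_{i,t})$, $(Y_k)$ are mutually independent. A user served at slot $t$ by the BS $X_i$ while located at $\mathbf u\in\mathbb R^2$ has downlink rate $$\xi_{\mathbf u,i}(t)=\log\Bigl(1+\frac{H_{i,t}\|X_i-\mathbf u\|^{-\beta}}{\sum_{j\ne i}H_{j,t}\|X_j-\mathbf u\|^{-\beta}+\sigma^2}\Bigr).$$ The user is at slot $t=ns+k$ ($n\ge0$, $0\le k<s$) at the location $S(t)=\sum_{j=1}^nY_j+\frac ks Y_{n+1}$. Under periodic handover skipping with period $s$, it is served at slot $t=ns+k$ by the BS nearest to $S(ns)$; let $\xi(t)$ be its rate at slot $t$. Let $F_V$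 be the distribution function of the speed $V=\|Y_1\|/s$. Then, almost surely, the received powers at each slot have a finite sum, each $\xi(t)$ has a finite expectation, and the long-run expected downlink rate exists and is given by $$\mathcal T^{(1)}:=\lim_{m\to\infty}\frac1m\,\mathbb E\Bigl[\sum_{t=0}^{m-1}\xi(t)\Bigr]=\frac1s\sum_{t=0}^{s-1}\int_{[0,\infty)}\tau(tv)\,\mathrm dF_V(v),$$ where $$\tau(u)=\int_0^\infty\frac1z\exp\bigl(-\sigma^2z-\pi\lambda K_\beta z^{2/\beta}\bigr)\bigl(\mu(z,u)-1\bigr)\,\mathrm dz,\qquad K_\beta=\frac{2\pi}\beta\csc\frac{2\pi}\beta,$$ $$\mu(z,u)=2\pi\lambda\int_0^\infty r\exp\bigl(-\lambda[\pi r^2-J(r,z,u)]\bigr)\,\mathrm dr,\qquad J(r,z,u)=2z\int_0^\pi\!\!\int_0^r\frac{x}{z+w_{x,u,\phi}^{\beta}}\,\mathrm dx\,\mathrm d\phi,$$ with $w_{x,u,\phi}=\sqrt{x^2+u^2-2xu\cos\phi}$. The integrals defining $\mu(z,u)$ (for $z>0$, $u\ge0$) and $\tau(u)$ (for $u\ge0$),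 and the integrals against $F_V$, converge absolutely. -/

import Mathlib

open MeasureTheory ProbabilityTheory Filter Topology
open scoped ENNReal NNReal

namespace CellularNetwork

/-- The Euclidean plane, with the Euclidean norm and Lebesgue measure. -/
abbrev Plane : Type := EuclideanSpace ℝ (Fin 2)

section PoissonProcess

variable {Ω : Type*} [MeasurableSpace Ω]

/-- The random counting measure `Φ = ∑ i, δ_{X i}` of a sequence of random points. -/
noncomputable def countingMeasure (X : ℕ → Ω → Plane) (ω : Ω) : Measure Plane :=
  Measure.sum fun i => Measure.dirac (X i ω)

/-- `Φ = ∑ i, δ_{X i}` is a homogeneous Poisson point process of intensity `lam` on the plane: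
the number of points in a Borel set `B` of finite area is Poisson distributed with mean
`lam * area B`, and the numbers of points in finitely many disjoint Borel sets are independent. -/
structure IsHomogeneousPPP (P : Measure Ω) (lam : ℝ) (X : ℕ → Ω → Plane) : Prop where
  measurable : ∀ i, Measurable (X i)
  law_count : ∀ B : Set Plane, MeasurableSet B → volume B ≠ ∞ →
    P.map (fun ω => countingMeasure X ω B) =
      (poissonMeasure (ENNReal.ofReal lam * volume B).toNNReal).map (fun n : ℕ => (n : ℝ≥0∞))
  indep_count : ∀ (n : ℕ) (B : Fin n → Set Plane), (∀ i, MeasurableSet (B i)) →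
    Pairwise (fun i j => Disjoint (B i) (B j)) →
    iIndepFun (fun i ω => countingMeasure X ω (B i)) P

end PoissonProcess

section Network

/-! In this section `x j` is the location of base station `j`, `h j` is its fading variable in the
current slot, and `u` is the location of the user. -/

/-- The power received at `u` from base station `j`. -/
noncomputable def receivedPower (β : ℝ) (x : ℕ → Plane) (h : ℕ → ℝ) (u : Plane) (j : ℕ) : ℝ :=
  h j * ‖x j - u‖ ^ (-β)

/-- The total power received at `u` from all base stations other than `i`. -/
noncomputable def interference (β : ℝ) (x : ℕ → Plane) (h : ℕ → ℝ) (u : Plane) (i : ℕ) : ℝ :=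
  ∑' j : {j : ℕ // j ≠ i}, receivedPower β x h u j

/-- The signal-to-interference-plus-noise ratio at `u` when served by base station `i`;
the noise power is `σ ^ 2`. -/
noncomputable def sinr (β σ : ℝ) (x : ℕ → Plane) (h : ℕ → ℝ) (u : Plane) (i : ℕ) : ℝ :=
  receivedPower β x h u i / (interference β x h u i + σ ^ 2)

/-- The instantaneous downlink data rate at `u` when served by base station `i`. -/
noncomputable def dataRate (β σ : ℝ) (x : ℕ → Plane) (h : ℕ → ℝ) (u : Plane) (i : ℕ) : ℝ :=
  Real.log (1 + sinr β σ x h u i)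

/-- The index of the base station nearest to `u`. For a homogeneous Poisson process the nearest
point to a given location exists and is unique almost surely; a tie is resolved by the smallest
index. -/
noncomputable def nearestIndex (x : ℕ → Plane) (u : Plane) : ℕ :=
  sInf {i : ℕ | ∀ j, ‖x i - u‖ ≤ ‖x j - u‖}

end Network

section Mobility

/-- The location at slot `t` of a user that starts at the origin and, during its `n`-th cycle of
`s` slots (`n = 0, 1, …`), moves along a straight segment at constant velocity, with total
displacement `y n` over the cycle. -/
noncomputable def position (s : ℕ) (y : ℕ → Plane) (t : ℕ) : Plane :=
  (∑ k ∈ Finset.range (t / s), y k) + (((t % s : ℕ) : ℝ) / (s : ℝ)) • y (t / s)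

/-- Under periodic handover skipping with period `s`, the base station serving the user at slot
`t` is the one that was nearest to the user at the first slot `s * (t / s)` of the current
cycle. -/
noncomputable def servingIndex (s : ℕ) (x : ℕ → Plane) (y : ℕ → Plane) (t : ℕ) : ℕ :=
  nearestIndex x (position s y (s * (t / s)))

variable {Ω : Type*}

/-- The instantaneous downlink data rate of the user at slot `t` under periodic handover skipping
with period `s`. -/
noncomputable def skippingRate (β σ : ℝ) (s : ℕ) (X : ℕ → Ω → Plane) (H : ℕ → ℕ → Ω → ℝ)
    (Y : ℕ → Ω → Plane) (t : ℕ) (ω : Ω) : ℝ :=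
  dataRate β σ (fun i => X i ω) (fun i => H i t ω) (position s (fun k => Y k ω) t)
    (servingIndex s (fun i => X i ω) (fun k => Y k ω) t)

end Mobility

section Formula

/-- `K_β = (2π/β) csc (2π/β)`. -/
noncomputable def Kβ (β : ℝ) : ℝ :=
  (2 * Real.pi / β) * (Real.sin (2 * Real.pi / β))⁻¹

/-- `w_{x,u,φ} = √(x² + u² - 2 x u cos φ)`. -/
noncomputable def wdist (x u φ : ℝ) : ℝ :=
  Real.sqrt (x ^ 2 + u ^ 2 - 2 * x * u * Real.cos φ)

/-- `J(r,z,u) = 2 z ∫_0^π ∫_0^r x / (z + w_{x,u,φ}^β) dx dφ`. -/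
noncomputable def Jdisk (β r z u : ℝ) : ℝ :=
  2 * z * ∫ φ in (0 : ℝ)..Real.pi, ∫ x in (0 : ℝ)..r, x / (z + wdist x u φ ^ β)

/-- The integrand of `μ(z,u)`, without the factor `2πλ`. -/
noncomputable def muIntegrand (lam β z u r : ℝ) : ℝ :=
  r * Real.exp (-lam * (Real.pi * r ^ 2 - Jdisk β r z u))

/-- `μ(z,u) = 2πλ ∫_0^∞ r exp(-λ [π r² - J(r,z,u)]) dr`. -/
noncomputable def mu (lam β z u : ℝ) : ℝ :=
  2 * Real.pi * lam * ∫ r in Set.Ioi (0 : ℝ), muIntegrand lam β z u r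

/-- The integrand of `τ(u)`. -/
noncomputable def tauIntegrand (lam β σ u z : ℝ) : ℝ :=
  1 / z * Real.exp (-σ ^ 2 * z - Real.pi * lam * Kβ β * z ^ (2 / β)) * (mu lam β z u - 1)

/-- `τ(u) = ∫_0^∞ (1/z) exp(-σ² z - πλ K_β z^{2/β}) (μ(z,u) - 1) dz`. -/
noncomputable def tau (lam β σ u : ℝ) : ℝ :=
  ∫ z in Set.Ioi (0 : ℝ), tauIntegrand lam β σ u z

end Formula

end CellularNetwork

open CellularNetwork

/-!
Fix the trajectory of the user, so that at a given slot it is at `b` and is served by the station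
nearest to `a`, where `‖b - a‖` is the distance travelled since the beginning of the cycle. With `S`
the received signal, `I` the interference and `N = I + σ ^ 2`, the Frullani integral
`log (1 + S / N) = ∫ (exp (-N z) - exp (-(N + S) z)) / z dz` (`ofReal_log_one_add_div`) reduces the
expected rate to two Laplace transforms: that of the interference `I` and that of the total received
power `I + S`. Averaging over the exponential fading replaces each weight `exp (-z H p)` by
`1 / (1 + z p)`, which leaves two multiplicative functionals of the Poisson process.

For the total power this is the Laplace functional of the process
(`IsHomogeneousPPP.laplace`), proved for simple functions from the independence of the counts and
extended by monotone convergence. It is stated for functions with values in `[0, ∞]`: the value `∞`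
on a ball imposes that the ball contains no point. The plane integral that appears is
`π K_β z ^ (2 / β)` (`lintegral_thinning`), by the reflection formula for the Gamma function.

For the interference, the station nearest to `a` has to be left out. Let `R` be its distance to `a`.
The event `r' ≤ R` and the points at distance at least `r ≥ r'` from `a` are independent, so
after discretising `R` from above and passing to the limit (`lintegral_rightLimit_eq`), the points
farther than `R` can be treated as a Poisson process outside a ball of deterministic radius, which is
then averaged over the law of `R` (`IsHomogeneousPPP.laplace_beyond_nearest`). Applied to a function
that is infinite on a ball, the same formula shows that the nearest point is almost surely unique
(`IsHomogeneousPPP.exists_unique_nearest`), so that the points farther than `R` are exactly the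
interfering ones. In polar coordinates around `a` the integral over the ball of radius `r` is
`J(r, z, ‖b - a‖)`, which gives `exp (-π λ K_β z ^ (2 / β)) μ(z, ‖b - a‖)` (`laplaceBeyond_eq`) and
hence `E ξ = τ(‖b - a‖)` (`IsHomogeneousPPP.lintegral_mixedRate`).

All convergence statements come from `0 ≤ J(r, z, u) ≤ min (π r ^ 2, π K_β z ^ (2 / β))`, which bounds
the integrand of `τ(u)` by an integrable function that does not depend on `u` (`tauIntegrand_le`). The
received powers have a finite sum because the Laplace transform of the total power tends to `1` at
`0`, and the interference does not vanish because its Laplace transform tends to `0` at `∞`; thus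
`dataRate` takes no junk value almost surely. Finally the expected rate depends on the slot only
modulo `s`, because the displacements are identically distributed, and Cesàro means of periodic
sequences converge.
-/

namespace CellularNetwork

section

/-! ### The decreasing exponential on `[0, ∞]` -/

/-- The function `s ↦ exp (-s)` from `[0, ∞]` to `[0, 1]`, with `exp (-∞) = 0`. -/
noncomputable def expNeg (s : ℝ≥0∞) : ℝ≥0∞ := EReal.exp (-(s : EReal))

@[simp] lemma expNeg_zero : expNeg 0 = 1 := by simp [expNeg]

@[simp] lemma expNeg_top : expNeg ∞ = 0 := by simp [expNeg]

lemma continuous_expNeg : Continuous expNeg :=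
  ENNReal.continuous_exp.comp (continuous_neg.comp continuous_coe_ennreal_ereal)

lemma measurable_expNeg : Measurable expNeg := continuous_expNeg.measurable

lemma expNeg_antitone : Antitone expNeg := fun a b h =>
  EReal.exp_monotone (EReal.neg_le_neg_iff.2 (by exact_mod_cast h))

lemma expNeg_le_one (s : ℝ≥0∞) : expNeg s ≤ 1 := by
  simpa using expNeg_antitone (zero_le : 0 ≤ s)

lemma expNeg_ne_top (s : ℝ≥0∞) : expNeg s ≠ ∞ := ((expNeg_le_one s).trans_lt (by simp)).ne

lemma expNeg_add (a b : ℝ≥0∞) : expNeg (a + b) = expNeg a * expNeg b := by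
  unfold expNeg
  rw [EReal.coe_ennreal_add, EReal.neg_add (by simp) (by simp), sub_eq_add_neg, EReal.exp_add]

lemma expNeg_sum {ι : Type*} (s : Finset ι) (f : ι → ℝ≥0∞) :
    expNeg (∑ i ∈ s, f i) = ∏ i ∈ s, expNeg (f i) := by
  classical
  induction s using Finset.induction_on with
  | empty => simp
  | insert a s ha ih => rw [Finset.sum_insert ha, Finset.prod_insert ha, expNeg_add, ih]

lemma expNeg_ofReal {x : ℝ} (hx : 0 ≤ x) :
    expNeg (ENNReal.ofReal x) = ENNReal.ofReal (Real.exp (-x)) := by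
  unfold expNeg
  rw [EReal.coe_ennreal_ofReal, max_eq_left hx, ← EReal.coe_neg, EReal.exp_coe]

lemma expNeg_mul_natCast (c : ℝ≥0∞) (n : ℕ) : expNeg (c * n) = expNeg c ^ n := by
  have := expNeg_sum (Finset.range n) (fun _ => c)
  simpa [mul_comm] using this

lemma expNeg_eq_ofReal (c : ℝ≥0∞) : expNeg c = ENNReal.ofReal (expNeg c).toReal :=
  (ENNReal.ofReal_toReal (expNeg_ne_top c)).symm

/-! ### The Laplace functional of a Poisson process -/

lemma lintegral_expNeg_poissonMeasure (m : ℝ≥0) (c : ℝ≥0∞) :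
    ∫⁻ n : ℕ, expNeg (c * n) ∂poissonMeasure m = expNeg (m * (1 - expNeg c)) := by
  set q := (expNeg c).toReal with hq
  have hq0 : 0 ≤ q := ENNReal.toReal_nonneg
  have hq1 : q ≤ 1 := by
    simpa using ENNReal.toReal_mono (by simp) (expNeg_le_one c)
  have hsum : HasSum (fun n : ℕ => Real.exp (-m) * ((m : ℝ) * q) ^ n / n.factorial)
      (Real.exp (-m) * Real.exp (m * q)) := by
    have := (NormedSpace.expSeries_div_hasSum_exp ((m : ℝ) * q)).mul_left (Real.exp (-m))
    simpa [mul_div_assoc, ← Real.exp_eq_exp_ℝ] using this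
  have hterm : ∀ n : ℕ, ENNReal.ofReal (Real.exp (-m) * (m : ℝ) ^ n / n.factorial) *
      expNeg (c * n) = ENNReal.ofReal (Real.exp (-m) * ((m : ℝ) * q) ^ n / n.factorial) := by
    intro n
    rw [expNeg_mul_natCast, expNeg_eq_ofReal c, ← hq, ← ENNReal.ofReal_pow hq0,
      ← ENNReal.ofReal_mul (by positivity)]
    congr 1
    rw [mul_pow]
    ring
  have hlim : (m : ℝ≥0∞) * (1 - expNeg c) = ENNReal.ofReal (m * (1 - q)) := by
    rw [ENNReal.ofReal_mul m.coe_nonneg, ENNReal.ofReal_sub _ hq0, ENNReal.ofReal_one,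
      ← expNeg_eq_ofReal, ENNReal.ofReal_coe_nnreal]
  rw [poissonMeasure, lintegral_sum_measure]
  simp only [lintegral_smul_measure, lintegral_dirac, smul_eq_mul, hterm]
  rw [← ENNReal.ofReal_tsum_of_nonneg (fun n => by positivity) hsum.summable, hsum.tsum_eq, hlim,
    expNeg_ofReal (mul_nonneg m.coe_nonneg (by linarith)), ← Real.exp_add]
  congr 2
  ring

lemma lintegral_countingMeasure {Ω : Type*} (X : ℕ → Ω → Plane) (ω : Ω) {f : Plane → ℝ≥0∞}
    (hf : Measurable f) : ∫⁻ x, f x ∂countingMeasure X ω = ∑' i, f (X i ω) := by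
  simp [countingMeasure, lintegral_sum_measure, lintegral_dirac' _ hf]

variable {Ω : Type*} [MeasurableSpace Ω]

lemma measurable_tsum_comp {X : ℕ → Ω → Plane} (hX : ∀ i, Measurable (X i))
    {f : Plane → ℝ≥0∞} (hf : Measurable f) : Measurable fun ω => ∑' i, f (X i ω) :=
  Measurable.tsum fun i => hf.comp (hX i)

lemma measurable_countingMeasure_apply {X : ℕ → Ω → Plane} (hX : ∀ i, Measurable (X i))
    {B : Set Plane} (hB : MeasurableSet B) : Measurable fun ω => countingMeasure X ω B := by
  have := measurable_tsum_comp hX (f := B.indicator 1) (measurable_one.indicator hB)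
  convert! this with ω
  simp [countingMeasure, Measure.sum_apply _ hB, Measure.dirac_apply' _ hB]

variable {P : Measure Ω} [IsProbabilityMeasure P] {lam : ℝ} {X : ℕ → Ω → Plane}

lemma IsHomogeneousPPP.lintegral_expNeg_mul_count (hX : IsHomogeneousPPP P lam X)
    {B : Set Plane} (hB : MeasurableSet B) (c : ℝ≥0∞) (hc : c ≠ 0 → volume B ≠ ∞) :
    ∫⁻ ω, expNeg (c * countingMeasure X ω B) ∂P =
      expNeg (ENNReal.ofReal lam * ((1 - expNeg c) * volume B)) := by
  by_cases h0 : c = 0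
  · simp [h0]
  have hv := hc h0
  have hm := measurable_countingMeasure_apply hX.measurable hB
  have hg : Measurable fun y : ℝ≥0∞ => expNeg (c * y) :=
    measurable_expNeg.comp (measurable_const.mul measurable_id)
  rw [← lintegral_map hg hm, hX.law_count B hB hv,
    lintegral_map hg .of_discrete, lintegral_expNeg_poissonMeasure,
    ENNReal.coe_toNNReal (ENNReal.mul_ne_top ENNReal.ofReal_ne_top hv)]
  congr 1
  ring

lemma IsHomogeneousPPP.laplace_simpleFunc (hX : IsHomogeneousPPP P lam X)
    (f : SimpleFunc Plane ℝ≥0∞) (hf : ∀ c ≠ 0, volume (f ⁻¹' {c}) ≠ ∞) :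
    ∫⁻ ω, expNeg (∫⁻ x, f x ∂countingMeasure X ω) ∂P =
      expNeg (ENNReal.ofReal lam * ∫⁻ x, (1 - expNeg (f x))) := by
  classical
  set n := f.range.card
  let c : Fin n → ℝ≥0∞ := fun i => (f.range.equivFin.symm i : ℝ≥0∞)
  have hsum : ∀ g : ℝ≥0∞ → ℝ≥0∞, ∑ y ∈ f.range, g y = ∑ i, g (c i) := by
    intro g
    rw [← Finset.sum_coe_sort]
    exact (f.range.equivFin.symm.sum_comp (fun y => g (y : ℝ≥0∞))).symm
  have hcinj : Function.Injective c := fun i j h =>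
    f.range.equivFin.symm.injective (Subtype.ext h)
  let B : Fin n → Set Plane := fun i => f ⁻¹' {c i}
  have hB : ∀ i, MeasurableSet (B i) := fun i => f.measurableSet_preimage _
  have hdisj : Pairwise fun i j => Disjoint (B i) (B j) := by
    intro i j hij
    refine Disjoint.preimage _ ?_
    simpa using fun h => hij (hcinj h)
  have hind := hX.indep_count n B hB hdisj
  have hind' := hind.comp (fun i y => expNeg (c i * y))
    (fun i => measurable_expNeg.comp (measurable_const.mul measurable_id))
  have h1 : ∀ ω, expNeg (∫⁻ x, f x ∂countingMeasure X ω) =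
      ∏ i, expNeg (c i * countingMeasure X ω (B i)) := by
    intro ω
    rw [SimpleFunc.lintegral_eq_lintegral, SimpleFunc.lintegral,
      hsum (fun y => y * countingMeasure X ω (f ⁻¹' {y})), expNeg_sum]
  have h2 : ∫⁻ x, (1 - expNeg (f x)) = ∑ i, (1 - expNeg (c i)) * volume (B i) := by
    have := SimpleFunc.lintegral_eq_lintegral (f.map fun y => 1 - expNeg y) volume
    rw [SimpleFunc.map_lintegral, hsum (fun y => (1 - expNeg y) * volume (f ⁻¹' {y}))] at this
    simpa using this
  simp_rw [h1]
  rw [h2, Finset.mul_sum, expNeg_sum]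
  have := lintegral_prod_eq_prod_lintegral_of_indepFun Finset.univ _ hind' (fun i =>
    (measurable_expNeg.comp (measurable_const.mul measurable_id)).comp
      (measurable_countingMeasure_apply hX.measurable (hB i)))
  refine Eq.trans ?_ (this.trans (Finset.prod_congr rfl fun i _ => ?_))
  · simp
  · exact hX.lintegral_expNeg_mul_count (hB i) (c i) (hf (c i))

/-- The Laplace functional of a homogeneous Poisson process, for functions that may take the
value `∞`; such values impose that a set contains no point of the process. -/
theorem IsHomogeneousPPP.laplace (hX : IsHomogeneousPPP P lam X) {f : Plane → ℝ≥0∞}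
    (hf : Measurable f) :
    ∫⁻ ω, expNeg (∑' i, f (X i ω)) ∂P =
      expNeg (ENNReal.ofReal lam * ∫⁻ x, (1 - expNeg (f x))) := by
  -- truncation to balls gives the nonzero levels finite area, where the law of the count is known
  let g : ℕ → SimpleFunc Plane ℝ≥0∞ := fun n =>
    (SimpleFunc.eapprox f n).restrict (Metric.ball 0 n)
  have hgapp : ∀ n x, g n x = (Metric.ball (0 : Plane) n).indicator (SimpleFunc.eapprox f n) x :=
    fun n x => SimpleFunc.restrict_apply _ Metric.isOpen_ball.measurableSet x
  have hgmono : ∀ x, Monotone fun n => g n x := by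
    intro x n m hnm
    simp only [hgapp]
    refine (Set.indicator_le_indicator_of_subset
      (Metric.ball_subset_ball (Nat.cast_le.2 hnm)) (fun _ => zero_le) x).trans ?_
    exact Set.indicator_le_indicator (SimpleFunc.monotone_eapprox f hnm x)
  have hgtend : ∀ x, Tendsto (fun n => g n x) atTop (𝓝 (f x)) := by
    intro x
    refine (SimpleFunc.tendsto_eapprox hf x).congr' ?_
    obtain ⟨N, hN⟩ := exists_nat_gt ‖x‖
    filter_upwards [eventually_ge_atTop N] with n hn
    rw [hgapp, Set.indicator_of_mem]
    simpa using hN.trans_le (by exact_mod_cast hn)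
  have hgfin : ∀ n, ∀ c ≠ 0, volume (g n ⁻¹' {c}) ≠ ∞ := by
    intro n c hc
    refine ((measure_mono ?_).trans_lt (measure_ball_lt_top (x := (0 : Plane)) (r := n))).ne
    intro x hx
    by_contra hxn
    simp only [Set.mem_preimage, Set.mem_singleton_iff, hgapp, Set.indicator_of_notMem hxn] at hx
    exact hc hx.symm
  have hL : Tendsto (fun n => ∫⁻ ω, expNeg (∫⁻ x, g n x ∂countingMeasure X ω) ∂P) atTop
      (𝓝 (∫⁻ ω, expNeg (∑' i, f (X i ω)) ∂P)) := by
    refine tendsto_lintegral_of_dominated_convergence (fun _ => 1) ?_ ?_ (by simp) ?_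
    · intro n
      simp_rw [lintegral_countingMeasure X _ (g n).measurable]
      exact measurable_expNeg.comp (measurable_tsum_comp hX.measurable (g n).measurable)
    · exact fun n => ae_of_all _ fun ω => expNeg_le_one _
    · refine ae_of_all _ fun ω => (continuous_expNeg.tendsto _).comp ?_
      rw [← lintegral_countingMeasure X ω hf]
      exact lintegral_tendsto_of_tendsto_of_monotone (fun n => (g n).measurable.aemeasurable)
        (ae_of_all _ hgmono) (ae_of_all _ hgtend)
  have hR : Tendsto (fun n => expNeg (ENNReal.ofReal lam * ∫⁻ x, (1 - expNeg (g n x)))) atTop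
      (𝓝 (expNeg (ENNReal.ofReal lam * ∫⁻ x, (1 - expNeg (f x))))) := by
    refine (continuous_expNeg.tendsto _).comp (ENNReal.Tendsto.const_mul ?_ (Or.inr (by simp)))
    refine lintegral_tendsto_of_tendsto_of_monotone
      (fun n => (measurable_const.sub (measurable_expNeg.comp (g n).measurable)).aemeasurable)
      (ae_of_all _ fun x n m hnm => tsub_le_tsub_left (expNeg_antitone (hgmono x hnm)) _)
      (ae_of_all _ fun x => ?_)
    exact ENNReal.Tendsto.sub tendsto_const_nhds ((continuous_expNeg.tendsto _).comp (hgtend x))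
      (Or.inl (by simp))
  refine tendsto_nhds_unique hL (hR.congr fun n => ?_)
  exact (hX.laplace_simpleFunc (g n) (hgfin n)).symm

end

section

/-! ### Conditioning on the distance to the nearest point -/

lemma tendsto_measure_le_nhdsGT {α : Type*} [MeasurableSpace α] (ν : Measure α) (D : α → ℝ)
    (r : ℝ) : Tendsto (fun ρ => ν {x | ρ ≤ D x}) (𝓝[>] r) (𝓝 (ν {x | r < D x})) := by
  have hanti : Antitone fun ρ => ν {x | ρ ≤ D x} := fun ρ ρ' h =>
    measure_mono fun x (hx : ρ' ≤ D x) => h.trans hx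
  have hlim := hanti.tendsto_nhdsGT r
  obtain ⟨u, hu_anti, hu_gt, hu_lim⟩ := exists_seq_strictAnti_tendsto r
  have hu : Tendsto u atTop (𝓝[>] r) :=
    tendsto_nhdsWithin_iff.2 ⟨hu_lim, Eventually.of_forall hu_gt⟩
  have hunion : {x | r < D x} = ⋃ n, {x | u n ≤ D x} := by
    ext x
    simp only [Set.mem_ofPred_eq, Set.mem_iUnion]
    constructor
    · intro hx
      obtain ⟨n, hn⟩ := (hu_lim.eventually (gt_mem_nhds hx)).exists
      exact ⟨n, hn.le⟩
    · rintro ⟨n, hn⟩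
      exact (hu_gt n).trans_le hn
  have hseq : Tendsto (fun n => ν {x | u n ≤ D x}) atTop (𝓝 (ν {x | r < D x})) := by
    rw [hunion]
    exact tendsto_measure_iUnion_atTop
      fun n m h x (hx : u n ≤ D x) => (hu_anti.antitone h).trans hx
  rwa [tendsto_nhds_unique (hlim.comp hu) hseq] at hlim

lemma tendsto_setLIntegral_le_nhdsGT {α : Type*} [MeasurableSpace α] (ν : Measure α)
    {D : α → ℝ} (hD : Measurable D) (f : α → ℝ≥0∞) (r : ℝ) :
    Tendsto (fun ρ => ∫⁻ x in {x | ρ ≤ D x}, f x ∂ν) (𝓝[>] r)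
      (𝓝 (∫⁻ x in {x | r < D x}, f x ∂ν)) := by
  have := tendsto_measure_le_nhdsGT (ν.withDensity f) D r
  rw [withDensity_apply _ (measurableSet_lt measurable_const hD)] at this
  refine this.congr fun ρ => ?_
  rw [withDensity_apply _ (measurableSet_le measurable_const hD)]

section Freezing

variable {Ω : Type*} [MeasurableSpace Ω] {P : Measure Ω} [IsProbabilityMeasure P]

/-- If the event `r' ≤ R` is uncorrelated with the bounded variable `Ψ r` of mean `φ r` whenever
`r' ≤ r`, then the mean of the right limit of `Ψ` at the random time `R` is obtained by replacing
`Ψ` with `φ`. -/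
lemma lintegral_rightLimit_eq {R : Ω → ℝ} (hR : Measurable R) (hR0 : ∀ ω, 0 ≤ R ω)
    {Ψ : ℝ → Ω → ℝ≥0∞} (hΨ : ∀ r, Measurable (Ψ r)) (hΨ1 : ∀ r ω, Ψ r ω ≤ 1)
    {φ : ℝ → ℝ≥0∞} (hφ1 : ∀ r, φ r ≤ 1)
    (h : ∀ r' r, r' ≤ r → ∫⁻ ω in {ω | r' ≤ R ω}, Ψ r ω ∂P = P {ω | r' ≤ R ω} * φ r)
    {Ψ₀ : Ω → ℝ≥0∞} (hΨ₀ : ∀ ω, Tendsto (fun r => Ψ r ω) (𝓝[>] (R ω)) (𝓝 (Ψ₀ ω)))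
    {φ₀ : ℝ → ℝ≥0∞} (hφ₀ : ∀ r, Tendsto φ (𝓝[>] r) (𝓝 (φ₀ r))) :
    ∫⁻ ω, Ψ₀ ω ∂P = ∫⁻ ω, φ₀ (R ω) ∂P := by
  -- `R` is approximated from above by the right end of its cell in the mesh of size `1 / (n + 1)`
  let K : ℕ → Ω → ℕ := fun n ω => ⌊((n : ℝ) + 1) * R ω⌋₊
  let ρ : ℕ → ℕ → ℝ := fun n k => ((k : ℝ) + 1) / ((n : ℝ) + 1)
  have hK : ∀ n, Measurable (K n) := fun n => Nat.measurable_floor.comp (hR.const_mul _)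
  have hpos : ∀ n : ℕ, (0 : ℝ) < (n : ℝ) + 1 := fun n => by positivity
  have hgt : ∀ n ω, R ω < ρ n (K n ω) := by
    intro n ω
    rw [lt_div_iff₀ (hpos n), mul_comm]
    exact Nat.lt_floor_add_one _
  have hle : ∀ n ω, ρ n (K n ω) ≤ R ω + 1 / ((n : ℝ) + 1) := by
    intro n ω
    have := Nat.floor_le (mul_nonneg (hpos n).le (hR0 ω))
    rw [div_le_iff₀ (hpos n), add_mul, one_div_mul_cancel (hpos n).ne']
    simp only [K]
    linarith
  have hlim : ∀ ω, Tendsto (fun n => ρ n (K n ω)) atTop (𝓝[>] (R ω)) := by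
    intro ω
    refine tendsto_nhdsWithin_iff.2 ⟨?_, Eventually.of_forall fun n => hgt n ω⟩
    refine tendsto_of_tendsto_of_tendsto_of_le_of_le tendsto_const_nhds ?_
      (fun n => (hgt n ω).le) (fun n => hle n ω)
    simpa using (tendsto_const_nhds (x := R ω)).add
      (tendsto_one_div_add_atTop_nhds_zero_nat (𝕜 := ℝ))
  have hcell : ∀ n k, {ω | K n ω = k} =
      {ω | (k : ℝ) / ((n : ℝ) + 1) ≤ R ω} \ {ω | ρ n k ≤ R ω} := by
    intro n k
    ext ω
    simp only [Set.mem_ofPred_eq, Set.mem_sdiff, not_le, K, ρ]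
    rw [Nat.floor_eq_iff (mul_nonneg (hpos n).le (hR0 ω)), div_le_iff₀ (hpos n),
      lt_div_iff₀ (hpos n), mul_comm]
  have hmeas : ∀ r, MeasurableSet {ω | r ≤ R ω} := fun r => measurableSet_le measurable_const hR
  have hcellint : ∀ n k, ∫⁻ ω in {ω | K n ω = k}, Ψ (ρ n k) ω ∂P =
      ∫⁻ ω in {ω | K n ω = k}, φ (ρ n k) ∂P := by
    intro n k
    set A := {ω | (k : ℝ) / ((n : ℝ) + 1) ≤ R ω}
    set B := {ω | ρ n k ≤ R ω}
    have hkρ : (k : ℝ) / ((n : ℝ) + 1) ≤ ρ n k := by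
      simp only [ρ]
      gcongr
      linarith
    have hBA : B ⊆ A := fun ω (hω : ρ n k ≤ R ω) => hkρ.trans hω
    have hsplit : ∀ g : Ω → ℝ≥0∞, ∫⁻ ω in B, g ω ∂P + ∫⁻ ω in A \ B, g ω ∂P =
        ∫⁻ ω in A, g ω ∂P := by
      intro g
      have := lintegral_inter_add_sdiff (μ := P) g A (hmeas (ρ n k))
      rwa [Set.inter_eq_right.2 hBA] at this
    have e1 := hsplit (Ψ (ρ n k))
    have e2 := hsplit (fun _ => φ (ρ n k))
    rw [h _ _ hkρ, h _ _ le_rfl] at e1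
    simp only [setLIntegral_const, mul_comm (φ _)] at e2
    rw [← e2] at e1
    rw [hcell, setLIntegral_const, mul_comm]
    refine (ENNReal.add_right_inj ?_).1 e1
    exact ENNReal.mul_ne_top (measure_ne_top _ _) ((hφ1 _).trans_lt (by simp)).ne
  have huniv : ∀ n, (⋃ k, {ω | K n ω = k}) = Set.univ := fun n => by
    ext ω
    simp
  have hdisj : ∀ n, Pairwise (Function.onFun Disjoint fun k => {ω | K n ω = k}) := by
    intro n i j hij
    refine Set.disjoint_left.2 fun ω hi hj => hij ?_
    exact (hi : K n ω = i).symm.trans hj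
  have hsum : ∀ n (g : Ω → ℝ≥0∞), ∫⁻ ω, g ω ∂P = ∑' k, ∫⁻ ω in {ω | K n ω = k}, g ω ∂P := by
    intro n g
    rw [← lintegral_iUnion (s := fun k => {ω | K n ω = k})
      (fun k => hK n (measurableSet_singleton k)) (hdisj n), huniv,
      Measure.restrict_univ]
  have heq : ∀ n, ∫⁻ ω, Ψ (ρ n (K n ω)) ω ∂P = ∫⁻ ω, φ (ρ n (K n ω)) ∂P := by
    intro n
    rw [hsum n, hsum n]
    refine tsum_congr fun k => ?_
    have hc : MeasurableSet {ω | K n ω = k} := hK n (measurableSet_singleton k)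
    rw [setLIntegral_congr_fun (g := Ψ (ρ n k)) hc (fun ω (hω : K n ω = k) => by simp [hω]),
      hcellint]
    exact setLIntegral_congr_fun hc (fun ω (hω : K n ω = k) => by simp [hω])
  have hmeasΨ : ∀ n, Measurable fun ω => Ψ (ρ n (K n ω)) ω := by
    intro n
    have : Measurable fun p : ℕ × Ω => Ψ (ρ n p.1) p.2 :=
      measurable_from_prod_countable_right fun k => hΨ (ρ n k)
    exact this.comp ((hK n).prodMk measurable_id)
  have hL := tendsto_lintegral_of_dominated_convergence (μ := P) (fun _ => (1 : ℝ≥0∞))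
    hmeasΨ (fun n => ae_of_all _ fun ω => hΨ1 _ _) (by simp)
    (ae_of_all _ fun ω => (hΨ₀ ω).comp (hlim ω))
  have hR' := tendsto_lintegral_of_dominated_convergence (μ := P)
    (F := fun n ω => φ (ρ n (K n ω))) (fun _ => (1 : ℝ≥0∞))
    (fun n => (measurable_of_countable fun k => φ (ρ n k)).comp (hK n))
    (fun n => ae_of_all _ fun ω => hφ1 _) (by simp)
    (ae_of_all _ fun ω => (hφ₀ (R ω)).comp (hlim ω))
  exact tendsto_nhds_unique hL (hR'.congr fun n => (heq n).symm)

end Freezing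

/-- The distance from `a` to the point set `{x 0, x 1, …}`. -/
noncomputable def nearestDist (x : ℕ → Plane) (a : Plane) : ℝ := ⨅ i, ‖x i - a‖

lemma bddBelow_range_dist (x : ℕ → Plane) (a : Plane) :
    BddBelow (Set.range fun i => ‖x i - a‖) := ⟨0, by rintro _ ⟨i, rfl⟩; exact norm_nonneg _⟩

lemma nearestDist_le (x : ℕ → Plane) (a : Plane) (i : ℕ) : nearestDist x a ≤ ‖x i - a‖ :=
  ciInf_le (bddBelow_range_dist x a) i

lemma nearestDist_nonneg (x : ℕ → Plane) (a : Plane) : 0 ≤ nearestDist x a :=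
  Real.iInf_nonneg fun _ => norm_nonneg _

lemma le_nearestDist_iff (x : ℕ → Plane) (a : Plane) (r : ℝ) :
    r ≤ nearestDist x a ↔ ∀ i, r ≤ ‖x i - a‖ := le_ciInf_iff (bddBelow_range_dist x a)

variable {Ω : Type*} [MeasurableSpace Ω] {P : Measure Ω} [IsProbabilityMeasure P] {lam : ℝ}
  {X : ℕ → Ω → Plane}

lemma measurable_nearestDist (hX : ∀ i, Measurable (X i)) (a : Plane) :
    Measurable fun ω => nearestDist (fun i => X i ω) a :=
  Measurable.iInf fun i => ((hX i).sub_const a).norm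

lemma measurable_norm_sub_const (a : Plane) : Measurable fun x : Plane => ‖x - a‖ :=
  (measurable_id.sub_const a).norm

/-- The Laplace functional of the points at distance at least `r` from `a`, on the event that no
point is at distance less than `r' ≤ r`. -/
lemma IsHomogeneousPPP.laplace_of_le_nearestDist (hX : IsHomogeneousPPP P lam X) (a : Plane)
    {f : Plane → ℝ≥0∞} (hf : Measurable f) {r' r : ℝ} (hr : r' ≤ r) :
    ∫⁻ ω in {ω | r' ≤ nearestDist (fun i => X i ω) a},
        expNeg (∫⁻ x in {x | r ≤ ‖x - a‖}, f x ∂countingMeasure X ω) ∂P =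
      expNeg (ENNReal.ofReal lam * volume (Metric.ball a r')) *
        expNeg (ENNReal.ofReal lam * ∫⁻ x in {x | r ≤ ‖x - a‖}, (1 - expNeg (f x))) := by
  set S : Set Plane := {x | r ≤ ‖x - a‖}
  have hS : MeasurableSet S := measurableSet_le measurable_const (measurable_norm_sub_const a)
  have hB : MeasurableSet (Metric.ball a r') := Metric.isOpen_ball.measurableSet
  have hBS : ∀ x ∈ Metric.ball a r', x ∉ S := by
    intro x hx hxS
    rw [Metric.mem_ball, dist_eq_norm] at hx
    exact absurd (hr.trans hxS) (not_le.2 hx)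
  let g : Plane → ℝ≥0∞ := fun x => (Metric.ball a r').indicator (fun _ => ∞) x + S.indicator f x
  have hg : Measurable g := (measurable_const.indicator hB).add (hf.indicator hS)
  have h1 : ∀ ω, {ω | r' ≤ nearestDist (fun i => X i ω) a}.indicator
      (fun ω => expNeg (∫⁻ x in S, f x ∂countingMeasure X ω)) ω =
        expNeg (∑' i, g (X i ω)) := by
    intro ω
    by_cases hω : r' ≤ nearestDist (fun i => X i ω) a
    · rw [Set.indicator_of_mem (by exact hω), ← lintegral_indicator hS,
        lintegral_countingMeasure X ω (hf.indicator hS)]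
      congr 2 with i
      have : X i ω ∉ Metric.ball a r' := by
        rw [Metric.mem_ball, dist_eq_norm, not_lt]
        exact (le_nearestDist_iff _ _ _).1 hω i
      simp [g, this]
    · rw [Set.indicator_of_notMem (by exact hω)]
      rw [le_nearestDist_iff] at hω
      push Not at hω
      obtain ⟨i, hi⟩ := hω
      have hmem : X i ω ∈ Metric.ball a r' := by rwa [Metric.mem_ball, dist_eq_norm]
      have : ∑' i, g (X i ω) = ∞ := by
        refine top_unique (le_trans (le_of_eq ?_) (ENNReal.le_tsum i))
        simp [g, hmem]
      rw [this, expNeg_top]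
  have h2 : ∀ x, 1 - expNeg (g x) =
      (Metric.ball a r').indicator 1 x + S.indicator (fun x => 1 - expNeg (f x)) x := by
    intro x
    by_cases hx : x ∈ Metric.ball a r'
    · simp [g, hx, hBS x hx]
    · by_cases hxS : x ∈ S <;> simp [g, hx, hxS]
  rw [← lintegral_indicator (measurableSet_le measurable_const
    (measurable_nearestDist hX.measurable a))]
  simp_rw [h1]
  rw [hX.laplace hg]
  simp_rw [h2]
  rw [lintegral_add_left (measurable_one.indicator hB), lintegral_indicator_one hB,
    lintegral_indicator hS, mul_add, expNeg_add]

lemma IsHomogeneousPPP.measure_le_nearestDist (hX : IsHomogeneousPPP P lam X) (a : Plane)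
    (r : ℝ) : P {ω | r ≤ nearestDist (fun i => X i ω) a} =
      expNeg (ENNReal.ofReal lam * volume (Metric.ball a r)) := by
  simpa using hX.laplace_of_le_nearestDist a (f := 0) measurable_zero (le_refl r)

/-- The Laplace functional of the points farther from `a` than the nearest one: given the distance
`R` to the nearest point, the points beyond `R` still form a Poisson process. -/
theorem IsHomogeneousPPP.laplace_beyond_nearest (hX : IsHomogeneousPPP P lam X) (a : Plane)
    {f : Plane → ℝ≥0∞} (hf : Measurable f) :
    ∫⁻ ω, expNeg (∑' i, {x | nearestDist (fun i => X i ω) a < ‖x - a‖}.indicator f (X i ω)) ∂P =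
      ∫⁻ ω, expNeg (ENNReal.ofReal lam *
        ∫⁻ x in {x | nearestDist (fun i => X i ω) a < ‖x - a‖}, (1 - expNeg (f x))) ∂P := by
  have hD := measurable_norm_sub_const a
  have hle : ∀ r, MeasurableSet {x : Plane | r ≤ ‖x - a‖} := fun r =>
    measurableSet_le measurable_const hD
  have hlt : ∀ r, MeasurableSet {x : Plane | r < ‖x - a‖} := fun r =>
    measurableSet_lt measurable_const hD
  have key := lintegral_rightLimit_eq (P := P) (measurable_nearestDist hX.measurable a)
    (fun ω => nearestDist_nonneg _ a)
    (Ψ := fun r ω => expNeg (∫⁻ x in {x | r ≤ ‖x - a‖}, f x ∂countingMeasure X ω))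
    (fun r => by
      simp_rw [← lintegral_indicator (hle r), lintegral_countingMeasure X _ (hf.indicator (hle r))]
      exact measurable_expNeg.comp (measurable_tsum_comp hX.measurable (hf.indicator (hle r))))
    (fun r ω => expNeg_le_one _)
    (φ := fun r => expNeg (ENNReal.ofReal lam * ∫⁻ x in {x | r ≤ ‖x - a‖}, (1 - expNeg (f x))))
    (fun r => expNeg_le_one _)
    (fun r' r hr => by
      rw [hX.laplace_of_le_nearestDist a hf hr, hX.measure_le_nearestDist a r'])
    (fun ω => (continuous_expNeg.tendsto _).comp (tendsto_setLIntegral_le_nhdsGT _ hD f _))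
    (φ₀ := fun r => expNeg (ENNReal.ofReal lam * ∫⁻ x in {x | r < ‖x - a‖}, (1 - expNeg (f x))))
    (fun r => (continuous_expNeg.tendsto _).comp (ENNReal.Tendsto.const_mul
      (tendsto_setLIntegral_le_nhdsGT _ hD _ r) (Or.inr (by simp))))
  rw [← key]
  refine lintegral_congr fun ω => ?_
  rw [← lintegral_indicator (hlt _), lintegral_countingMeasure X ω (hf.indicator (hlt _))]

end

section

/-! ### The nearest point of a Poisson process -/

lemma lintegral_Ioi_rayleigh {k q : ℝ} (hk : 0 < k) (hq : 0 ≤ q) :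
    ∫⁻ r in Set.Ioi q, ENNReal.ofReal (2 * k * (r * Real.exp (-k * r ^ 2))) =
      ENNReal.ofReal (Real.exp (-k * q ^ 2)) := by
  have hder : ∀ r ∈ Set.Ici q, HasDerivAt (fun r : ℝ => -Real.exp (-k * r ^ 2))
      (2 * k * (r * Real.exp (-k * r ^ 2))) r := by
    intro r _
    have := (((hasDerivAt_pow 2 r).const_mul (-k)).exp).neg
    convert! this using 1
    push_cast
    ring
  have hpos : ∀ r ∈ Set.Ioi q, 0 ≤ 2 * k * (r * Real.exp (-k * r ^ 2)) := by
    intro r hr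
    have : 0 < r := hq.trans_lt hr
    positivity
  have hlim : Tendsto (fun r : ℝ => -Real.exp (-k * r ^ 2)) atTop (𝓝 0) := by
    have h1 : Tendsto (fun r : ℝ => -k * r ^ 2) atTop atBot :=
      (tendsto_pow_atTop two_ne_zero).const_mul_atTop_of_neg (neg_lt_zero.2 hk)
    simpa using (Real.tendsto_exp_atBot.comp h1).neg
  rw [← ofReal_integral_eq_lintegral_ofReal (integrableOn_Ioi_deriv_of_nonneg' hder hpos hlim)
    (ae_restrict_of_forall_mem measurableSet_Ioi hpos),
    integral_Ioi_of_hasDerivAt_of_nonneg' hder hpos hlim]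
  simp

lemma volume_ball_plane (a : Plane) (r : ℝ) :
    volume (Metric.ball a r) = ENNReal.ofReal r ^ 2 * ENNReal.ofReal Real.pi := by
  rw [EuclideanSpace.volume_ball_fin_two, ← NNReal.coe_real_pi, ENNReal.ofReal_coe_nnreal]

lemma volume_closedBall_plane (a : Plane) (r : ℝ) :
    volume (Metric.closedBall a r) = ENNReal.ofReal r ^ 2 * ENNReal.ofReal Real.pi := by
  rw [EuclideanSpace.volume_closedBall_fin_two, ← NNReal.coe_real_pi, ENNReal.ofReal_coe_nnreal]

lemma ofReal_mul_volume_ball {lam : ℝ} (hlam : 0 < lam) (a : Plane) {r : ℝ} (hr : 0 ≤ r) :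
    ENNReal.ofReal lam * volume (Metric.ball a r) = ENNReal.ofReal (lam * Real.pi * r ^ 2) := by
  rw [volume_ball_plane, ← ENNReal.ofReal_pow hr, ← ENNReal.ofReal_mul (by positivity),
    ← ENNReal.ofReal_mul hlam.le]
  congr 1
  ring

/-- The density of the distance from a fixed location to the nearest point of a homogeneous
Poisson process of intensity `lam` (a Rayleigh density). -/
noncomputable def nearestDensity (lam r : ℝ) : ℝ :=
  2 * (lam * Real.pi) * (r * Real.exp (-(lam * Real.pi) * r ^ 2))

lemma continuous_nearestDensity (lam : ℝ) : Continuous (nearestDensity lam) := by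
  unfold nearestDensity
  fun_prop

variable {Ω : Type*} [MeasurableSpace Ω] {P : Measure Ω} {lam : ℝ} {X : ℕ → Ω → Plane}

lemma IsHomogeneousPPP.count_ball_ne_top (hX : IsHomogeneousPPP P lam X) (a : Plane) (q : ℝ) :
    ∀ᵐ ω ∂P, countingMeasure X ω (Metric.ball a q) ≠ ∞ := by
  have hB : MeasurableSet (Metric.ball a q) := Metric.isOpen_ball.measurableSet
  have hm := measurable_countingMeasure_apply hX.measurable hB
  have h := hX.law_count _ hB measure_ball_lt_top.ne
  rw [ae_iff]
  have h1 : {ω | ¬countingMeasure X ω (Metric.ball a q) ≠ ∞} =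
      (fun ω => countingMeasure X ω (Metric.ball a q)) ⁻¹' {∞} := by
    ext ω
    simp
  rw [h1, ← Measure.map_apply hm (measurableSet_singleton _), h,
    Measure.map_apply .of_discrete (measurableSet_singleton _)]
  convert! measure_empty (μ := poissonMeasure _)
  ext n
  simp

lemma IsHomogeneousPPP.measure_count_ball_le_one (hX : IsHomogeneousPPP P lam X)
    (hlam : 0 < lam) (a : Plane) {q : ℝ} (hq : 0 ≤ q) :
    P {ω | countingMeasure X ω (Metric.ball a q) ≤ 1} =
      ENNReal.ofReal (Real.exp (-(lam * Real.pi * q ^ 2)) * (1 + lam * Real.pi * q ^ 2)) := by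
  have hB : MeasurableSet (Metric.ball a q) := Metric.isOpen_ball.measurableSet
  have hm := measurable_countingMeasure_apply hX.measurable hB
  have h := hX.law_count _ hB measure_ball_lt_top.ne
  have hpos : 0 ≤ lam * Real.pi * q ^ 2 := by positivity
  have h1 : {ω | countingMeasure X ω (Metric.ball a q) ≤ 1} =
      (fun ω => countingMeasure X ω (Metric.ball a q)) ⁻¹' Set.Iic 1 := rfl
  rw [ofReal_mul_volume_ball hlam a hq] at h
  rw [h1, ← Measure.map_apply hm measurableSet_Iic, h,
    Measure.map_apply .of_discrete measurableSet_Iic]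
  have h2 : (fun n : ℕ => (n : ℝ≥0∞)) ⁻¹' Set.Iic 1 = {0} ∪ {1} := by
    ext n
    simp only [Set.mem_preimage, Set.mem_Iic, Nat.cast_le_one, Set.mem_union,
      Set.mem_singleton_iff]
    omega
  have hcoe : (((ENNReal.ofReal (lam * Real.pi * q ^ 2)).toNNReal : ℝ≥0) : ℝ) =
      lam * Real.pi * q ^ 2 := ENNReal.toReal_ofReal hpos
  rw [h2, measure_union (by simp) (measurableSet_singleton _), poissonMeasure_singleton,
    poissonMeasure_singleton, ← ENNReal.ofReal_add (by positivity) (by positivity), hcoe]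
  congr 1
  simp
  ring

variable [IsProbabilityMeasure P]

lemma IsHomogeneousPPP.map_nearestDist (hX : IsHomogeneousPPP P lam X) (hlam : 0 < lam)
    (a : Plane) : P.map (fun ω => nearestDist (fun i => X i ω) a) =
      (volume.restrict (Set.Ioi 0)).withDensity
        (fun r => ENNReal.ofReal (nearestDensity lam r)) := by
  have hm := measurable_nearestDist hX.measurable a
  have := Measure.isProbabilityMeasure_map (μ := P) hm.aemeasurable
  have hlp : 0 < lam * Real.pi := by positivity
  refine Measure.ext_of_Ici _ _ fun r => ?_
  rw [Measure.map_apply hm measurableSet_Ici, withDensity_apply _ measurableSet_Ici]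
  change P {ω | r ≤ nearestDist (fun i => X i ω) a} = _
  rw [hX.measure_le_nearestDist, Measure.restrict_restrict measurableSet_Ici]
  rcases le_or_gt r 0 with hr | hr
  · rw [Metric.ball_eq_empty.2 hr, Set.inter_eq_right.2
      (show Set.Ioi 0 ⊆ Set.Ici r from fun x hx => hr.trans (le_of_lt hx))]
    simpa [nearestDensity] using (lintegral_Ioi_rayleigh hlp le_rfl).symm
  · rw [Set.inter_eq_left.2
      (show Set.Ici r ⊆ Set.Ioi 0 from fun x hx => hr.trans_le hx),
      setLIntegral_congr Ioi_ae_eq_Ici.symm, ofReal_mul_volume_ball hlam a hr.le,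
      expNeg_ofReal (by positivity)]
    simpa [nearestDensity] using (lintegral_Ioi_rayleigh hlp hr.le).symm

lemma IsHomogeneousPPP.lintegral_comp_nearestDist (hX : IsHomogeneousPPP P lam X)
    (hlam : 0 < lam) (a : Plane) {φ : ℝ → ℝ≥0∞} (hφ : Measurable φ) :
    ∫⁻ ω, φ (nearestDist (fun i => X i ω) a) ∂P =
      ∫⁻ r in Set.Ioi 0, ENNReal.ofReal (nearestDensity lam r) * φ r := by
  rw [← lintegral_map hφ (measurable_nearestDist hX.measurable a), hX.map_nearestDist hlam,
    lintegral_withDensity_eq_lintegral_mul _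
      (continuous_nearestDensity lam).measurable.ennreal_ofReal hφ]
  rfl

/-- Almost surely, if no point of the process lies strictly between the nearest point to `a` and
the circle of radius `q`, then the ball of radius `q` contains at most one point: the first event
contains the second one and has the same probability. -/
lemma IsHomogeneousPPP.count_ball_le_one_of_gap (hX : IsHomogeneousPPP P lam X)
    (hlam : 0 < lam) (a : Plane) {q : ℝ} (hq : 0 ≤ q) :
    ∀ᵐ ω ∂P, (∀ i, nearestDist (fun i => X i ω) a < ‖X i ω - a‖ → q ≤ ‖X i ω - a‖) →
      countingMeasure X ω (Metric.ball a q) ≤ 1 := by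
  have hB : MeasurableSet (Metric.ball a q) := Metric.isOpen_ball.measurableSet
  have hD := measurable_norm_sub_const a
  have hlt : ∀ r, MeasurableSet {x : Plane | r < ‖x - a‖} := fun r =>
    measurableSet_lt measurable_const hD
  have hcount : ∀ ω, countingMeasure X ω (Metric.ball a q) =
      ∑' i, (Metric.ball a q).indicator 1 (X i ω) := by
    intro ω
    simp [countingMeasure, Measure.sum_apply _ hB, Measure.dirac_apply' _ hB]
  set R : Ω → ℝ := fun ω => nearestDist (fun i => X i ω) a with hR
  have hRm : Measurable R := measurable_nearestDist hX.measurable a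
  set A : Set Ω := {ω | ∀ i, R ω < ‖X i ω - a‖ → q ≤ ‖X i ω - a‖} with hA
  set N : Set Ω := {ω | countingMeasure X ω (Metric.ball a q) ≤ 1} with hN
  have hAm : MeasurableSet A := by
    have : A = ⋂ i, {ω | R ω < ‖X i ω - a‖}ᶜ ∪ {ω | q ≤ ‖X i ω - a‖} := by
      ext ω
      simp [hA, imp_iff_not_or]
    rw [this]
    exact MeasurableSet.iInter fun i =>
      ((measurableSet_lt hRm (hD.comp (hX.measurable i))).compl).union
        (measurableSet_le measurable_const (hD.comp (hX.measurable i)))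
  have hNA : N ⊆ A := by
    intro ω hω i hi
    by_contra hqi
    rw [not_le] at hqi
    obtain ⟨j, hj⟩ : ∃ j, ‖X j ω - a‖ < ‖X i ω - a‖ := by
      by_contra! hno
      exact absurd ((le_nearestDist_iff _ _ _).2 hno) (not_le.2 hi)
    have hij : i ≠ j := by
      rintro rfl
      exact lt_irrefl _ hj
    have h2 : (2 : ℝ≥0∞) ≤ countingMeasure X ω (Metric.ball a q) := by
      rw [hcount]
      refine le_trans (le_of_eq ?_) (ENNReal.sum_le_tsum {i, j})
      have hi' : X i ω ∈ Metric.ball a q := by rwa [Metric.mem_ball, dist_eq_norm]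
      have hj' : X j ω ∈ Metric.ball a q := by
        rw [Metric.mem_ball, dist_eq_norm]
        exact hj.trans hqi
      rw [Finset.sum_pair hij, Set.indicator_of_mem hi', Set.indicator_of_mem hj']
      exact one_add_one_eq_two.symm
    exact absurd (h2.trans hω) (by norm_num)
  have hPA : P A ≤ P N := by
    let f : Plane → ℝ≥0∞ := (Metric.ball a q).indicator fun _ => ∞
    have hf : Measurable f := measurable_const.indicator hB
    have h1 : P A = ∫⁻ ω, expNeg (∑' i, {x | R ω < ‖x - a‖}.indicator f (X i ω)) ∂P := by
      rw [← lintegral_indicator_one hAm]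
      refine lintegral_congr fun ω => ?_
      by_cases hω : ω ∈ A
      · rw [Set.indicator_of_mem hω]
        have : ∀ i, {x | R ω < ‖x - a‖}.indicator f (X i ω) = 0 := by
          intro i
          refine Set.indicator_apply_eq_zero.2 fun hi => Set.indicator_of_notMem ?_ _
          rw [Metric.mem_ball, dist_eq_norm, not_lt]
          exact hω i hi
        simp [this]
      · rw [Set.indicator_of_notMem hω]
        simp only [hA, Set.mem_ofPred_eq, not_forall, not_le] at hω
        obtain ⟨i, hi, hqi⟩ := hω
        have : ∑' i, {x | R ω < ‖x - a‖}.indicator f (X i ω) = ∞ := by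
          refine top_unique (le_trans (le_of_eq ?_) (ENNReal.le_tsum i))
          have hmem : X i ω ∈ Metric.ball a q := by rwa [Metric.mem_ball, dist_eq_norm]
          rw [Set.indicator_of_mem (by exact hi)]
          simp [f, hmem]
        rw [this, expNeg_top]
    let φ : ℝ → ℝ≥0∞ := fun r =>
      expNeg (ENNReal.ofReal lam * ∫⁻ x in {x : Plane | r < ‖x - a‖}, (1 - expNeg (f x)))
    have hφmono : Monotone φ := by
      intro r r' h
      refine expNeg_antitone ?_
      gcongr
    have hφ : ∀ r, 0 ≤ r → r < q → φ r ≤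
        ENNReal.ofReal (Real.exp (-(lam * Real.pi * q ^ 2) + lam * Real.pi * r ^ 2)) := by
      intro r hr hrq
      have hrq2 : r ^ 2 ≤ q ^ 2 := by gcongr
      have hlp : 0 < lam * Real.pi := by positivity
      have : lam * Real.pi * r ^ 2 ≤ lam * Real.pi * q ^ 2 := by gcongr
      rw [show -(lam * Real.pi * q ^ 2) + lam * Real.pi * r ^ 2 =
        -(lam * Real.pi * q ^ 2 - lam * Real.pi * r ^ 2) by ring, ← expNeg_ofReal (by linarith)]
      refine expNeg_antitone ?_
      have e : ∀ x, 1 - expNeg (f x) = (Metric.ball a q).indicator 1 x := by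
        intro x
        by_cases hx : x ∈ Metric.ball a q <;> simp [f, hx]
      simp_rw [e]
      rw [lintegral_indicator_one hB, Measure.restrict_apply hB]
      have hdiff : Metric.ball a q ∩ {x | r < ‖x - a‖} =
          Metric.ball a q \ Metric.closedBall a r := by
        ext x
        simp [dist_eq_norm]
      rw [hdiff]
      calc ENNReal.ofReal (lam * Real.pi * q ^ 2 - lam * Real.pi * r ^ 2)
          = ENNReal.ofReal lam *
            (volume (Metric.ball a q) - volume (Metric.closedBall a r)) := by
            rw [ENNReal.mul_sub (fun _ _ => ENNReal.ofReal_ne_top), ofReal_mul_volume_ball hlam a hq,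
              volume_closedBall_plane, ← volume_ball_plane a, ofReal_mul_volume_ball hlam a hr,
              ENNReal.ofReal_sub _ (by positivity)]
        _ ≤ _ := by
            gcongr
            exact le_measure_sdiff
    rw [h1, hX.laplace_beyond_nearest a hf]
    rw [hX.lintegral_comp_nearestDist hlam a (φ := φ) hφmono.measurable,
      hX.measure_count_ball_le_one hlam a hq]
    have hsplit : Set.Ioi (0 : ℝ) ⊆ Set.Ioc 0 q ∪ Set.Ioi q := by
      intro x hx
      rcases le_or_gt x q with h | h
      · exact Or.inl ⟨hx, h⟩
      · exact Or.inr h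
    refine (lintegral_mono_set hsplit).trans ((lintegral_union_le _ _ _).trans ?_)
    rw [mul_add, mul_one, add_comm (Real.exp _), ENNReal.ofReal_add (by positivity) (by positivity)]
    refine add_le_add ?_ ?_
    · rw [← setLIntegral_congr Ioo_ae_eq_Ioc]
      calc ∫⁻ r in Set.Ioo 0 q, ENNReal.ofReal (nearestDensity lam r) * φ r
          ≤ ∫⁻ r in Set.Ioo 0 q, ENNReal.ofReal
              (2 * (lam * Real.pi) * Real.exp (-(lam * Real.pi * q ^ 2)) * r) := by
            refine setLIntegral_mono (by fun_prop) fun r hr => ?_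
            have hr0 : 0 ≤ r := hr.1.le
            refine (mul_le_mul_right (hφ r hr0 hr.2) _).trans (le_of_eq ?_)
            rw [← ENNReal.ofReal_mul (by unfold nearestDensity; positivity)]
            congr 1
            unfold nearestDensity
            rw [Real.exp_add, neg_mul, Real.exp_neg (lam * Real.pi * r ^ 2)]
            field_simp
        _ = ENNReal.ofReal (∫ r in (0 : ℝ)..q,
              2 * (lam * Real.pi) * Real.exp (-(lam * Real.pi * q ^ 2)) * r) := by
            rw [intervalIntegral.integral_of_le hq, setLIntegral_congr Ioo_ae_eq_Ioc,
              ofReal_integral_eq_lintegral_ofReal]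
            · exact (by fun_prop : Continuous _).integrableOn_Ioc
            · refine ae_restrict_of_forall_mem measurableSet_Ioc fun r hr => ?_
              have : 0 ≤ r := hr.1.le
              positivity
        _ ≤ _ := by
            refine le_of_eq ?_
            rw [intervalIntegral.integral_const_mul, integral_id]
            congr 1
            ring
    · calc ∫⁻ r in Set.Ioi q, ENNReal.ofReal (nearestDensity lam r) * φ r
          ≤ ∫⁻ r in Set.Ioi q, ENNReal.ofReal (nearestDensity lam r) :=
            lintegral_mono fun r => mul_le_of_le_one_right' (expNeg_le_one _)
        _ = _ := by
            have := lintegral_Ioi_rayleigh (k := lam * Real.pi) (by positivity) hq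
            rw [neg_mul] at this
            exact this
  have := ae_eq_of_subset_of_measure_ge hNA hPA (nullMeasurableSet_le
    (measurable_countingMeasure_apply hX.measurable hB).aemeasurable aemeasurable_const)
    (measure_ne_top _ _)
  filter_upwards [this] with ω hω
  intro h
  exact (iff_of_eq hω).2 h

/-- Almost surely exactly one point of a homogeneous Poisson process is nearest to `a`. -/
theorem IsHomogeneousPPP.exists_unique_nearest (hX : IsHomogeneousPPP P lam X) (hlam : 0 < lam)
    (a : Plane) : ∀ᵐ ω ∂P, ∃ i, ∀ j ≠ i, ‖X i ω - a‖ < ‖X j ω - a‖ := by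
  have h1 : ∀ᵐ ω ∂P, ∀ q : ℚ, countingMeasure X ω (Metric.ball a q) ≠ ∞ :=
    ae_all_iff.2 fun q => hX.count_ball_ne_top a q
  have h2 : ∀ᵐ ω ∂P, ∀ q : ℚ, 0 ≤ (q : ℝ) →
      (∀ i, nearestDist (fun i => X i ω) a < ‖X i ω - a‖ → q ≤ ‖X i ω - a‖) →
        countingMeasure X ω (Metric.ball a q) ≤ 1 := by
    refine ae_all_iff.2 fun q => ?_
    by_cases hq : 0 ≤ (q : ℝ)
    · filter_upwards [hX.count_ball_le_one_of_gap hlam a hq] with ω h _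
      exact h
    · exact ae_of_all _ fun ω h => absurd h hq
  filter_upwards [h1, h2] with ω hfin hgap
  set R := nearestDist (fun i => X i ω) a
  have hcount : ∀ q : ℝ, countingMeasure X ω (Metric.ball a q) =
      ∑' i, (Metric.ball a q).indicator 1 (X i ω) := by
    intro q
    have hB : MeasurableSet (Metric.ball a q) := Metric.isOpen_ball.measurableSet
    simp [countingMeasure, Measure.sum_apply _ hB, Measure.dirac_apply' _ hB]
  obtain ⟨q₀, hq₀⟩ := exists_rat_gt R
  have hfinite : {i | ‖X i ω - a‖ < q₀}.Finite := by
    have := hfin q₀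
    rw [hcount] at this
    refine (ENNReal.finite_const_le_of_tsum_ne_top this one_ne_zero).subset fun i hi => ?_
    have hmem : X i ω ∈ Metric.ball a q₀ := by rwa [Metric.mem_ball, dist_eq_norm]
    simp [hmem]
  -- a rational radius beyond `R` with no point strictly in between
  obtain ⟨q, hRq, hq⟩ : ∃ q : ℚ, R < q ∧ ∀ i, R < ‖X i ω - a‖ → (q : ℝ) ≤ ‖X i ω - a‖ := by
    have hev : ∀ᶠ r in 𝓝[>] R, ∀ i ∈ {i | ‖X i ω - a‖ < q₀}, R < ‖X i ω - a‖ →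
        r ≤ ‖X i ω - a‖ := by
      rw [hfinite.eventually_all]
      intro i _
      by_cases hi : R < ‖X i ω - a‖
      · filter_upwards [Ioc_mem_nhdsGT hi] with r hr _
        exact hr.2
      · exact Eventually.of_forall fun r h => absurd h hi
    obtain ⟨r, ⟨hr, hRr, hrq⟩⟩ := (hev.and (Ioo_mem_nhdsGT hq₀)).exists
    obtain ⟨q, hq1, hq2⟩ := exists_rat_btwn hRr
    refine ⟨q, hq1, fun i hi => hq2.le.trans ?_⟩
    rcases lt_or_ge ‖X i ω - a‖ q₀ with h | h
    · exact hr i h hi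
    · exact hrq.le.trans h
  have hR0 : 0 ≤ R := nearestDist_nonneg _ a
  have hone := hgap q (hR0.trans hRq.le) hq
  obtain ⟨i, hi⟩ : ∃ i, ‖X i ω - a‖ < q := by
    by_contra! hno
    exact absurd ((le_nearestDist_iff (fun i => X i ω) a q).2 hno) (not_le.2 hRq)
  refine ⟨i, fun j hj => hi.trans_le ?_⟩
  by_contra! hlt
  have hi' : X i ω ∈ Metric.ball a q := by rwa [Metric.mem_ball, dist_eq_norm]
  have hj' : X j ω ∈ Metric.ball a q := by rwa [Metric.mem_ball, dist_eq_norm]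
  have h2 : (2 : ℝ≥0∞) ≤ countingMeasure X ω (Metric.ball a q) := by
    rw [hcount]
    refine le_trans (le_of_eq ?_) (ENNReal.sum_le_tsum {i, j})
    rw [Finset.sum_pair hj.symm, Set.indicator_of_mem hi', Set.indicator_of_mem hj']
    exact one_add_one_eq_two.symm
  exact absurd (h2.trans hone) (by norm_num)

lemma nearestDist_lt_iff_ne_nearestIndex {x : ℕ → Plane} {a : Plane} {i : ℕ}
    (hi : ∀ j ≠ i, ‖x i - a‖ < ‖x j - a‖) (j : ℕ) :
    nearestDist x a < ‖x j - a‖ ↔ j ≠ nearestIndex x a := by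
  have hset : {k : ℕ | ∀ j, ‖x k - a‖ ≤ ‖x j - a‖} = {i} := by
    ext k
    simp only [Set.mem_ofPred_eq, Set.mem_singleton_iff]
    constructor
    · intro hk
      by_contra hne
      exact absurd (hk i) (not_le.2 (hi k hne))
    · rintro rfl j
      by_cases hj : j = k
      · rw [hj]
      · exact (hi j hj).le
  have hidx : nearestIndex x a = i := by
    rw [nearestIndex, hset, csInf_singleton]
  have hR : nearestDist x a = ‖x i - a‖ := by
    refine le_antisymm (nearestDist_le x a i) ((le_nearestDist_iff _ _ _).2 fun j => ?_)
    by_cases hj : j = i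
    · rw [hj]
    · exact (hi j hj).le
  rw [hidx, hR]
  constructor
  · rintro h rfl
    exact lt_irrefl _ h
  · exact hi j

/-- The Laplace functional of all points but the nearest one to `a`. -/
theorem IsHomogeneousPPP.laplace_ne_nearestIndex (hX : IsHomogeneousPPP P lam X)
    (hlam : 0 < lam) (a : Plane) {f : Plane → ℝ≥0∞} (hf : Measurable f) :
    ∫⁻ ω, expNeg (∑' i, if i = nearestIndex (fun i => X i ω) a then 0 else f (X i ω)) ∂P =
      ∫⁻ r in Set.Ioi 0, ENNReal.ofReal (nearestDensity lam r) *
        expNeg (ENNReal.ofReal lam * ∫⁻ x in {x | r < ‖x - a‖}, (1 - expNeg (f x))) := by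
  have hmono : Monotone fun r : ℝ => expNeg (ENNReal.ofReal lam *
      ∫⁻ x in {x : Plane | r < ‖x - a‖}, (1 - expNeg (f x))) := by
    intro r r' h
    refine expNeg_antitone ?_
    gcongr
  rw [← hX.lintegral_comp_nearestDist hlam a hmono.measurable, ← hX.laplace_beyond_nearest a hf]
  refine lintegral_congr_ae ?_
  filter_upwards [hX.exists_unique_nearest hlam a] with ω ⟨i, hi⟩
  congr 1
  refine tsum_congr fun j => ?_
  have := nearestDist_lt_iff_ne_nearestIndex (x := fun i => X i ω) hi j
  by_cases hj : j = nearestIndex (fun i => X i ω) a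
  · rw [if_pos hj, Set.indicator_of_notMem]
    exact fun h => this.1 h hj
  · rw [if_neg hj, Set.indicator_of_mem (by exact this.2 hj)]

end

/-! ### Plane integrals of the fading kernel -/

lemma lintegral_rpow_mul_exp_neg_mul_rpow {p q b : ℝ} (hp : 0 < p) (hq : -1 < q) (hb : 0 < b) :
    ∫⁻ x in Set.Ioi (0 : ℝ), ENNReal.ofReal (x ^ q * Real.exp (-b * x ^ p)) =
      ENNReal.ofReal (b ^ (-(q + 1) / p) * (1 / p) * Real.Gamma ((q + 1) / p)) := by
  rw [← integral_rpow_mul_exp_neg_mul_rpow hp hq hb,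
    ofReal_integral_eq_lintegral_ofReal (integrableOn_rpow_mul_exp_neg_mul_rpow hq hp hb)]
  refine ae_restrict_of_forall_mem measurableSet_Ioi fun x (hx : 0 < x) => ?_
  positivity

lemma lintegral_exp_neg_mul {b : ℝ} (hb : 0 < b) :
    ∫⁻ t in Set.Ioi (0 : ℝ), ENNReal.ofReal (Real.exp (-b * t)) = ENNReal.ofReal b⁻¹ := by
  have := lintegral_rpow_mul_exp_neg_mul_rpow one_pos (q := 0) (by norm_num) hb
  simpa [Real.rpow_neg_one] using this

/-- A Beta integral, evaluated by the reflection formula for the Gamma function. -/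
lemma lintegral_mul_div_add_rpow {β z : ℝ} (hβ : 2 < β) (hz : 0 < z) :
    ∫⁻ x in Set.Ioi (0 : ℝ), ENNReal.ofReal (x * (z / (z + x ^ β))) =
      ENNReal.ofReal (Kβ β / 2 * z ^ (2 / β)) := by
  have hβ0 : 0 < β := by linarith
  have hs1 : 2 / β < 1 := (div_lt_one hβ0).2 hβ
  have hs0 : 0 < 2 / β := by positivity
  have h1 : ∀ x ∈ Set.Ioi (0 : ℝ), ENNReal.ofReal (x * (z / (z + x ^ β))) =
      ∫⁻ t in Set.Ioi (0 : ℝ), ENNReal.ofReal (z * Real.exp (-z * t)) *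
        ENNReal.ofReal (x ^ (1 : ℝ) * Real.exp (-t * x ^ β)) := by
    intro x (hx : 0 < x)
    have hxβ : 0 < x ^ β := Real.rpow_pos_of_pos hx β
    rw [div_eq_mul_inv, ← mul_assoc, ENNReal.ofReal_mul (by positivity),
      ← lintegral_exp_neg_mul (by positivity), ← lintegral_const_mul' _ _ (by simp)]
    refine lintegral_congr fun t => ?_
    rw [← ENNReal.ofReal_mul (by positivity), ← ENNReal.ofReal_mul (by positivity), neg_add,
      add_mul, Real.exp_add, Real.rpow_one]
    congr 1
    ring_nf
  rw [setLIntegral_congr_fun measurableSet_Ioi h1, lintegral_lintegral_swap (by fun_prop)]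
  have h2 : ∀ t ∈ Set.Ioi (0 : ℝ), ∫⁻ x in Set.Ioi (0 : ℝ),
      ENNReal.ofReal (z * Real.exp (-z * t)) *
        ENNReal.ofReal (x ^ (1 : ℝ) * Real.exp (-t * x ^ β)) =
      ENNReal.ofReal (z * (1 / β * Real.Gamma (2 / β))) *
        ENNReal.ofReal (t ^ (-(2 / β)) * Real.exp (-z * t ^ (1 : ℝ))) := by
    intro t (ht : 0 < t)
    rw [lintegral_const_mul' _ _ (by simp),
      lintegral_rpow_mul_exp_neg_mul_rpow hβ0 (by norm_num) ht,
      ← ENNReal.ofReal_mul (by positivity), ← ENNReal.ofReal_mul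
        (mul_nonneg hz.le (mul_nonneg (by positivity) (Real.Gamma_pos_of_pos hs0).le))]
    congr 1
    rw [Real.rpow_one, show (1 + 1 : ℝ) = 2 by norm_num, neg_div]
    ring
  rw [setLIntegral_congr_fun measurableSet_Ioi h2, lintegral_const_mul' _ _ (by simp),
    lintegral_rpow_mul_exp_neg_mul_rpow one_pos (by linarith) hz,
    ← ENNReal.ofReal_mul
      (mul_nonneg hz.le (mul_nonneg (by positivity) (Real.Gamma_pos_of_pos hs0).le))]
  congr 1
  have hG := Real.Gamma_mul_Gamma_one_sub (2 / β)
  rw [div_one, div_one, div_one, mul_one, show -(2 / β) + 1 = 1 - 2 / β by ring,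
    show -(1 - 2 / β) = 2 / β - 1 by ring, Real.rpow_sub hz, Real.rpow_one]
  calc z * (1 / β * Real.Gamma (2 / β)) * (z ^ (2 / β) / z * Real.Gamma (1 - 2 / β))
      = 1 / β * z ^ (2 / β) * (Real.Gamma (2 / β) * Real.Gamma (1 - 2 / β)) := by
        field_simp
    _ = Kβ β / 2 * z ^ (2 / β) := by
        rw [hG, Kβ, show Real.pi * (2 / β) = 2 * Real.pi / β by ring]
        ring

/-- Polar coordinates around `a` for a function of the distances to `a` and to `b`. -/
lemma lintegral_plane_polar (a b : Plane) {G : ℝ → ℝ → ℝ≥0∞}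
    (hG : Measurable (Function.uncurry G)) :
    ∫⁻ x : Plane, G ‖x - a‖ ‖x - b‖ =
      2 * ∫⁻ φ in Set.Ioo 0 Real.pi, ∫⁻ ρ in Set.Ioi (0 : ℝ),
        ENNReal.ofReal ρ * G ρ (wdist ρ ‖b - a‖ φ) := by
  -- an isometry of `ℂ` onto the plane that maps the positive real axis to the direction of `b - a`
  obtain ⟨L, hL⟩ : ∃ L : ℂ ≃ₗᵢ[ℝ] Plane, L (‖b - a‖ : ℂ) = b - a := by
    let c : ℂ := Complex.orthonormalBasisOneI.repr.symm (b - a)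
    have hc : ‖c‖ = ‖b - a‖ := LinearIsometryEquiv.norm_map _ _
    refine ⟨(rotation (Circle.exp c.arg)).trans Complex.orthonormalBasisOneI.repr, ?_⟩
    rw [LinearIsometryEquiv.trans_apply, rotation_apply, Circle.coe_exp, ← hc, mul_comm,
      Complex.norm_mul_exp_arg_mul_I]
    exact LinearIsometryEquiv.apply_symm_apply _ _
  set u := ‖b - a‖ with hu
  have h1 : ∫⁻ x : Plane, G ‖x - a‖ ‖x - b‖ = ∫⁻ w : ℂ, G ‖w‖ ‖w - u‖ := by
    rw [← lintegral_add_right_eq_self _ a,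
      ← L.measurePreserving.lintegral_comp_emb L.toHomeomorph.measurableEmbedding]
    refine lintegral_congr fun w => ?_
    have e1 : ‖L w + a - a‖ = ‖w‖ := by simp
    have e2 : ‖L w + a - b‖ = ‖w - u‖ := by
      rw [← L.norm_map (w - u), map_sub, hL]
      congr 1
      abel
    rw [e1, e2]
  have hw : ∀ ρ φ : ℝ, ‖(ρ : ℂ) * (Real.cos φ + Real.sin φ * Complex.I) - u‖ = wdist ρ u φ := by
    intro ρ φ
    rw [Complex.norm_eq_sqrt_sq_add_sq, wdist]
    congr 1
    simp only [Complex.sub_re, Complex.mul_re, Complex.ofReal_re, Complex.add_re, Complex.I_re,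
      mul_zero, Complex.ofReal_im, Complex.I_im, mul_one, zero_mul, sub_zero, add_zero,
      Complex.add_im, Complex.mul_im, Complex.sub_im, zero_add, sub_self]
    linear_combination ρ ^ 2 * Real.sin_sq_add_cos_sq φ
  have hmeas : Measurable fun p : ℝ × ℝ => ENNReal.ofReal p.1 * G p.1 (wdist p.1 u p.2) := by
    have hw : Measurable fun p : ℝ × ℝ => (p.1, wdist p.1 u p.2) := by
      unfold wdist
      fun_prop
    exact measurable_fst.ennreal_ofReal.mul (hG.comp hw)
  have hI : ∫⁻ x : Plane, G ‖x - a‖ ‖x - b‖ =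
      ∫⁻ φ in Set.Ioo (-Real.pi) Real.pi, ∫⁻ ρ in Set.Ioi (0 : ℝ),
        ENNReal.ofReal ρ * G ρ (wdist ρ u φ) := by
    rw [h1, ← Complex.lintegral_comp_polarCoord_symm, polarCoord_target]
    rw [Measure.volume_eq_prod, ← Measure.prod_restrict, ← lintegral_prod_symm _ hmeas.aemeasurable,
      Measure.prod_restrict]
    refine setLIntegral_congr_fun (measurableSet_Ioi.prod measurableSet_Ioo) fun p hp => ?_
    have hp0 : 0 < p.1 := hp.1
    rw [Complex.polarCoord_symm_apply, hw]
    have hn : ‖(p.1 : ℂ) * (Real.cos p.2 + Real.sin p.2 * Complex.I)‖ = p.1 := by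
      rw [norm_mul, Complex.norm_real, Real.norm_of_nonneg hp0.le, Complex.ofReal_cos,
        Complex.ofReal_sin, Complex.norm_cos_add_sin_mul_I, mul_one]
    rw [hn, smul_eq_mul]
  rw [hI]
  set F : ℝ → ℝ≥0∞ := fun φ => ∫⁻ ρ in Set.Ioi (0 : ℝ), ENNReal.ofReal ρ * G ρ (wdist ρ u φ)
  have hFeven : ∀ φ, F (-φ) = F φ := by
    intro φ
    simp only [F, wdist, Real.cos_neg]
  have hneg : ∫⁻ φ in Set.Ioo (-Real.pi) 0, F φ = ∫⁻ φ in Set.Ioo 0 Real.pi, F φ := by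
    have := (Measure.measurePreserving_neg (volume : Measure ℝ)).setLIntegral_comp_emb
      (Homeomorph.neg ℝ).measurableEmbedding F (Set.Ioo 0 Real.pi)
    simpa [hFeven] using this.symm
  have hpi := Real.pi_pos
  have hsplit : Set.Ioo (-Real.pi) Real.pi = Set.Ioc (-Real.pi) 0 ∪ Set.Ioo 0 Real.pi :=
    (Set.Ioc_union_Ioo_eq_Ioo (by linarith) hpi).symm
  rw [hsplit, lintegral_union measurableSet_Ioo, ← setLIntegral_congr Ioo_ae_eq_Ioc, hneg, two_mul]
  refine Set.disjoint_left.2 fun x hx hx' => ?_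
  exact absurd hx'.1 (not_lt.2 hx.2)

/-- The number `z / (z + ‖x - b‖ ^ β)`, which is one minus the mean of the fading weight
`exp (-z H ‖x - b‖ ^ (-β))` of a station at `x`: the probability that thinning the stations by this
weight deletes it. -/
noncomputable def thinning (β z : ℝ) (b x : Plane) : ℝ := z / (z + ‖x - b‖ ^ β)

lemma thinning_le_one {β z : ℝ} (hz : 0 < z) (b x : Plane) : thinning β z b x ≤ 1 := by
  unfold thinning
  have : 0 ≤ ‖x - b‖ ^ β := by positivity
  rw [div_le_one (by positivity)]
  linarith

lemma Kβ_pos {β : ℝ} (hβ : 2 < β) : 0 < Kβ β := by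
  have hβ0 : 0 < β := by linarith
  have hpi := Real.pi_pos
  have : 0 < Real.sin (2 * Real.pi / β) := by
    refine Real.sin_pos_of_pos_of_lt_pi (by positivity) ?_
    rw [div_lt_iff₀ hβ0]
    nlinarith
  unfold Kβ
  positivity

lemma lintegral_thinning {β z : ℝ} (hβ : 2 < β) (hz : 0 < z) (b : Plane) :
    ∫⁻ x, ENNReal.ofReal (thinning β z b x) =
      ENNReal.ofReal (Real.pi * Kβ β * z ^ (2 / β)) := by
  have := lintegral_plane_polar b b (G := fun ρ _ => ENNReal.ofReal (z / (z + ρ ^ β)))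
    (by unfold Function.uncurry; fun_prop)
  simp only [thinning]
  rw [this]
  have h2 : ∫⁻ ρ in Set.Ioi (0 : ℝ), ENNReal.ofReal ρ * ENNReal.ofReal (z / (z + ρ ^ β)) =
      ENNReal.ofReal (Kβ β / 2 * z ^ (2 / β)) := by
    rw [← lintegral_mul_div_add_rpow hβ hz]
    exact setLIntegral_congr_fun measurableSet_Ioi fun ρ (hρ : 0 < ρ) =>
      (ENNReal.ofReal_mul hρ.le).symm
  have hK := Kβ_pos hβ
  rw [h2, setLIntegral_const, Real.volume_Ioo, sub_zero,
    show (2 : ℝ≥0∞) = ENNReal.ofReal 2 by simp, ← ENNReal.ofReal_mul (by positivity),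
    ← ENNReal.ofReal_mul (by norm_num)]
  congr 1
  ring

lemma continuous_Jdisk_integrand {β z : ℝ} (hβ : 0 < β) (hz : 0 < z) (u : ℝ) :
    Continuous (Function.uncurry fun φ x : ℝ => x / (z + wdist x u φ ^ β)) := by
  have hw : Continuous fun p : ℝ × ℝ => wdist p.2 u p.1 := by
    unfold wdist
    fun_prop
  refine continuous_snd.div (continuous_const.add (hw.rpow_const fun _ => Or.inr hβ.le)) ?_
  intro p
  have : 0 ≤ wdist p.2 u p.1 ^ β := Real.rpow_nonneg (Real.sqrt_nonneg _) _
  positivity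

/-- The integral `J(r, z, u)` is the integral of the thinning probability over a disk. -/
lemma lintegral_closedBall_thinning {β z : ℝ} (hβ : 0 < β) (hz : 0 < z) (a b : Plane) {r : ℝ}
    (hr : 0 ≤ r) : ∫⁻ x in Metric.closedBall a r, ENNReal.ofReal (thinning β z b x) =
      ENNReal.ofReal (Jdisk β r z ‖b - a‖) := by
  set u := ‖b - a‖ with hu
  let G : ℝ → ℝ → ℝ≥0∞ := fun ρ w =>
    (Set.Iic r).indicator (fun _ => ENNReal.ofReal (z / (z + w ^ β))) ρ
  have hG : Measurable (Function.uncurry G) := by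
    have : Function.uncurry G = (Set.Iic r ×ˢ Set.univ).indicator
        (fun p : ℝ × ℝ => ENNReal.ofReal (z / (z + p.2 ^ β))) := by
      ext ⟨ρ, w⟩
      by_cases h : ρ ≤ r <;> simp [G, h]
    rw [this]
    exact Measurable.indicator (by fun_prop) (measurableSet_Iic.prod MeasurableSet.univ)
  have h1 : ∫⁻ x in Metric.closedBall a r, ENNReal.ofReal (thinning β z b x) =
      ∫⁻ x, G ‖x - a‖ ‖x - b‖ := by
    rw [← lintegral_indicator Metric.isClosed_closedBall.measurableSet]
    refine lintegral_congr fun x => ?_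
    by_cases hx : x ∈ Metric.closedBall a r
    · rw [Set.indicator_of_mem hx]
      rw [Metric.mem_closedBall, dist_eq_norm] at hx
      simp [G, hx, thinning]
    · rw [Set.indicator_of_notMem hx]
      rw [Metric.mem_closedBall, dist_eq_norm] at hx
      simp [G, hx]
  have hcont := continuous_Jdisk_integrand hβ hz u
  have hpos : ∀ φ x : ℝ, 0 ≤ x → 0 ≤ x / (z + wdist x u φ ^ β) := by
    intro φ x hx
    have : 0 ≤ wdist x u φ ^ β := Real.rpow_nonneg (Real.sqrt_nonneg _) _
    positivity
  have h2 : ∀ φ : ℝ, ∫⁻ ρ in Set.Ioi (0 : ℝ), ENNReal.ofReal ρ * G ρ (wdist ρ u φ) =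
      ENNReal.ofReal z *
        ENNReal.ofReal (∫ x in (0 : ℝ)..r, x / (z + wdist x u φ ^ β)) := by
    intro φ
    have hc : Continuous fun x : ℝ => x / (z + wdist x u φ ^ β) :=
      hcont.comp (Continuous.prodMk continuous_const continuous_id)
    rw [intervalIntegral.integral_of_le hr, ofReal_integral_eq_lintegral_ofReal hc.integrableOn_Ioc
      (ae_restrict_of_forall_mem measurableSet_Ioc fun x hx => hpos φ x hx.1.le),
      ← lintegral_const_mul' _ _ ENNReal.ofReal_ne_top, ← Set.Ioi_inter_Iic,
      Set.inter_comm, ← Measure.restrict_restrict measurableSet_Iic,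
      ← lintegral_indicator measurableSet_Iic]
    refine setLIntegral_congr_fun measurableSet_Ioi fun ρ (hρ : 0 < ρ) => ?_
    by_cases h : ρ ≤ r
    · simp only [G, Set.indicator_of_mem (show ρ ∈ Set.Iic r from h)]
      rw [← ENNReal.ofReal_mul hρ.le, ← ENNReal.ofReal_mul hz.le]
      congr 1
      ring
    · simp [G, h]
  have hcJ : Continuous fun φ : ℝ => ∫ x in (0 : ℝ)..r, x / (z + wdist x u φ ^ β) :=
    intervalIntegral.continuous_parametric_intervalIntegral_of_continuous' hcont 0 r
  have hint : ∀ φ : ℝ, 0 ≤ ∫ x in (0 : ℝ)..r, x / (z + wdist x u φ ^ β) := fun φ =>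
    intervalIntegral.integral_nonneg hr fun x hx => hpos φ x hx.1
  rw [h1, lintegral_plane_polar a b hG]
  simp_rw [← hu, h2]
  rw [lintegral_const_mul' _ _ ENNReal.ofReal_ne_top, setLIntegral_congr Ioo_ae_eq_Ioc,
    ← ofReal_integral_eq_lintegral_ofReal hcJ.integrableOn_Ioc (ae_of_all _ hint), Jdisk,
    intervalIntegral.integral_of_le Real.pi_pos.le, ← ENNReal.ofReal_mul hz.le,
    show (2 : ℝ≥0∞) = ENNReal.ofReal 2 by simp, ← ENNReal.ofReal_mul (by norm_num), mul_assoc]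

/-! ### Bounds for `J`, `μ` and `τ` -/

/-- The integral of the thinning probability over the whole plane. -/
noncomputable def thinningMass (β z : ℝ) : ℝ := Real.pi * Kβ β * z ^ (2 / β)

lemma thinningMass_nonneg {β z : ℝ} (hβ : 2 < β) (hz : 0 < z) : 0 ≤ thinningMass β z := by
  have := Kβ_pos hβ
  unfold thinningMass
  positivity

lemma norm_single_plane {u : ℝ} (hu : 0 ≤ u) :
    ‖(EuclideanSpace.single 0 u : Plane)‖ = u := by simp [abs_of_nonneg hu]

section Bounds

variable {β z u r : ℝ}

lemma lintegral_closedBall_thinning_axis (hβ : 2 < β) (hz : 0 < z) (hu : 0 ≤ u) (hr : 0 ≤ r) :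
    ∫⁻ x in Metric.closedBall 0 r,
        ENNReal.ofReal (thinning β z (EuclideanSpace.single 0 u : Plane) x) =
      ENNReal.ofReal (Jdisk β r z u) := by
  rw [lintegral_closedBall_thinning (by linarith) hz 0 _ hr, sub_zero, norm_single_plane hu]

lemma Jdisk_nonneg (hz : 0 < z) (hr : 0 ≤ r) : 0 ≤ Jdisk β r z u := by
  refine mul_nonneg (by positivity) ?_
  refine intervalIntegral.integral_nonneg Real.pi_pos.le fun φ _ => ?_
  refine intervalIntegral.integral_nonneg hr fun x hx => ?_
  have : 0 ≤ wdist x u φ ^ β := Real.rpow_nonneg (Real.sqrt_nonneg _) _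
  exact div_nonneg hx.1 (by positivity)

lemma Jdisk_le_thinningMass (hβ : 2 < β) (hz : 0 < z) (hu : 0 ≤ u) (hr : 0 ≤ r) :
    Jdisk β r z u ≤ thinningMass β z := by
  rw [← ENNReal.ofReal_le_ofReal_iff (thinningMass_nonneg hβ hz),
    ← lintegral_closedBall_thinning_axis hβ hz hu hr, thinningMass,
    ← lintegral_thinning hβ hz (EuclideanSpace.single 0 u : Plane)]
  exact setLIntegral_le_lintegral _ _

lemma Jdisk_le_area (hβ : 2 < β) (hz : 0 < z) (hu : 0 ≤ u) (hr : 0 ≤ r) :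
    Jdisk β r z u ≤ Real.pi * r ^ 2 := by
  rw [← ENNReal.ofReal_le_ofReal_iff (by positivity),
    ← lintegral_closedBall_thinning_axis hβ hz hu hr]
  calc _ ≤ ∫⁻ x in Metric.closedBall (0 : Plane) r, 1 :=
        lintegral_mono fun x => ENNReal.ofReal_le_one.2 (thinning_le_one hz _ _)
    _ = _ := by
        rw [setLIntegral_one, volume_closedBall_plane, ← ENNReal.ofReal_pow hr,
          ← ENNReal.ofReal_mul (by positivity), mul_comm]

lemma aestronglyMeasurable_muIntegrand (lam : ℝ) (hβ : 2 < β) (hz : 0 < z) (hu : 0 ≤ u) :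
    AEStronglyMeasurable (muIntegrand lam β z u) (volume.restrict (Set.Ioi 0)) := by
  let m : ℝ → ℝ≥0∞ := fun r => ∫⁻ x in Metric.closedBall 0 r,
    ENNReal.ofReal (thinning β z (EuclideanSpace.single 0 u : Plane) x)
  have hm : Measurable m := Monotone.measurable fun r r' h =>
    lintegral_mono_set (Metric.closedBall_subset_closedBall h)
  have hmeas : Measurable fun r : ℝ =>
      r * Real.exp (-lam * (Real.pi * r ^ 2 - (m r).toReal)) := by
    have := hm.ennreal_toReal
    fun_prop
  refine hmeas.aestronglyMeasurable.congr (ae_restrict_of_forall_mem measurableSet_Ioi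
    fun r (hr : 0 < r) => ?_)
  simp only [m]
  rw [lintegral_closedBall_thinning_axis hβ hz hu hr.le,
    ENNReal.toReal_ofReal (Jdisk_nonneg hz hr.le), muIntegrand]

variable {lam : ℝ}

lemma nearestDensity_nonneg (hlam : 0 < lam) (hr : 0 ≤ r) : 0 ≤ nearestDensity lam r := by
  unfold nearestDensity
  positivity

lemma lintegral_nearestDensity (hlam : 0 < lam) :
    ∫⁻ r in Set.Ioi 0, ENNReal.ofReal (nearestDensity lam r) = 1 := by
  have := lintegral_Ioi_rayleigh (k := lam * Real.pi) (by positivity) (le_refl 0)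
  simpa [nearestDensity] using this

lemma integrableOn_nearestDensity (hlam : 0 < lam) :
    IntegrableOn (nearestDensity lam) (Set.Ioi 0) := by
  refine (lintegral_ofReal_ne_top_iff_integrable
    (continuous_nearestDensity lam).aestronglyMeasurable ?_).1 ?_
  · exact ae_restrict_of_forall_mem measurableSet_Ioi
      fun r (hr : 0 < r) => nearestDensity_nonneg hlam hr.le
  · rw [lintegral_nearestDensity hlam]
    simp

lemma integral_nearestDensity (hlam : 0 < lam) :
    ∫ r in Set.Ioi 0, nearestDensity lam r = 1 := by
  rw [integral_eq_lintegral_of_nonneg_ae (ae_restrict_of_forall_mem measurableSet_Ioi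
    fun r (hr : 0 < r) => nearestDensity_nonneg hlam hr.le)
    (continuous_nearestDensity lam).aestronglyMeasurable, lintegral_nearestDensity hlam]
  simp

lemma mul_muIntegrand_eq (lam β z u r : ℝ) : 2 * Real.pi * lam * muIntegrand lam β z u r =
    nearestDensity lam r * Real.exp (lam * Jdisk β r z u) := by
  rw [muIntegrand, nearestDensity, mul_assoc _ (r * _), mul_assoc r, ← Real.exp_add]
  ring_nf

lemma integrableOn_muIntegrand (hlam : 0 < lam) (hβ : 2 < β) (hz : 0 < z) (hu : 0 ≤ u) :
    IntegrableOn (muIntegrand lam β z u) (Set.Ioi 0) := by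
  have hdom : IntegrableOn (fun r => nearestDensity lam r * ((2 * Real.pi * lam)⁻¹ *
      Real.exp (lam * thinningMass β z))) (Set.Ioi 0) :=
    (integrableOn_nearestDensity hlam).mul_const _
  refine hdom.mono' (aestronglyMeasurable_muIntegrand lam hβ hz hu)
    (ae_restrict_of_forall_mem measurableSet_Ioi fun r (hr : 0 < r) => ?_)
  have h0 : 0 ≤ muIntegrand lam β z u r := by
    unfold muIntegrand
    positivity
  have h1 := mul_muIntegrand_eq lam β z u r
  have h2 : muIntegrand lam β z u r = nearestDensity lam r * ((2 * Real.pi * lam)⁻¹ *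
      Real.exp (lam * Jdisk β r z u)) := by
    rw [mul_left_comm, ← h1]
    field_simp
  rw [Real.norm_of_nonneg h0, h2]
  have := nearestDensity_nonneg hlam hr.le
  have := Jdisk_le_thinningMass hβ hz hu hr.le
  gcongr

lemma mu_eq (lam β z u : ℝ) : mu lam β z u =
    ∫ r in Set.Ioi 0, 2 * Real.pi * lam * muIntegrand lam β z u r := by
  rw [mu, integral_const_mul]

lemma one_le_mu (hlam : 0 < lam) (hβ : 2 < β) (hz : 0 < z) (hu : 0 ≤ u) :
    1 ≤ mu lam β z u := by
  rw [mu_eq, ← integral_nearestDensity hlam]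
  refine setIntegral_mono_on (integrableOn_nearestDensity hlam)
    ((integrableOn_muIntegrand hlam hβ hz hu).const_mul _) measurableSet_Ioi
    fun r (hr : 0 < r) => ?_
  rw [mul_muIntegrand_eq]
  exact le_mul_of_one_le_right (nearestDensity_nonneg hlam hr.le)
    (Real.one_le_exp (mul_nonneg hlam.le (Jdisk_nonneg hz hr.le)))

/-- This follows from `exp x - 1 ≤ x * exp x` and `J ≤ thinningMass`. -/
lemma mu_sub_one_le (hlam : 0 < lam) (hβ : 2 < β) (hz : 0 < z) (hu : 0 ≤ u) :
    mu lam β z u - 1 ≤ lam * thinningMass β z * mu lam β z u := by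
  have hint := (integrableOn_muIntegrand hlam hβ hz hu).const_mul (2 * Real.pi * lam)
  rw [mu_eq, ← integral_nearestDensity hlam, ← integral_sub hint (integrableOn_nearestDensity hlam),
    ← integral_const_mul]
  refine setIntegral_mono_on (hint.sub (integrableOn_nearestDensity hlam)) (hint.const_mul _)
    measurableSet_Ioi fun r (hr : 0 < r) => ?_
  simp only [mul_muIntegrand_eq]
  have hd := nearestDensity_nonneg hlam hr.le
  have hJ := Jdisk_le_thinningMass hβ hz hu hr.le
  set x := lam * Jdisk β r z u with hx
  have hxle : x ≤ lam * thinningMass β z := by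
    rw [hx]
    gcongr
  have h1 : Real.exp x - 1 ≤ x * Real.exp x := by
    have := Real.add_one_le_exp (-x)
    have h2 : Real.exp x * Real.exp (-x) = 1 := by rw [← Real.exp_add]; simp
    nlinarith [Real.exp_pos x]
  have h3 : x * Real.exp x ≤ lam * thinningMass β z * Real.exp x := by gcongr
  nlinarith [mul_le_mul_of_nonneg_left (h1.trans h3) hd]

/-- Since `J` is at most both `π r ^ 2` and `thinningMass`, it is at most their average. -/
lemma exp_mul_mu_le (hlam : 0 < lam) (hβ : 2 < β) (hz : 0 < z) (hu : 0 ≤ u) :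
    Real.exp (-(lam * thinningMass β z)) * mu lam β z u ≤
      2 * Real.exp (-(lam * thinningMass β z / 2)) := by
  set c := thinningMass β z
  have hint := (integrableOn_muIntegrand hlam hβ hz hu).const_mul (2 * Real.pi * lam)
  have hlam2 : 0 < lam / 2 := by positivity
  rw [mu_eq, ← integral_const_mul,
    ← mul_one (2 * Real.exp _), ← integral_nearestDensity hlam2, ← integral_const_mul]
  refine setIntegral_mono_on (hint.const_mul _)
    ((integrableOn_nearestDensity hlam2).const_mul _)
    measurableSet_Ioi fun r (hr : 0 < r) => ?_
  have h1 : Jdisk β r z u ≤ c := Jdisk_le_thinningMass hβ hz hu hr.le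
  have h2 := Jdisk_le_area hβ hz hu hr.le
  have h3 : Real.exp (-(lam * c)) * (2 * Real.pi * lam * muIntegrand lam β z u r) =
      2 * Real.pi * lam * r *
        Real.exp (-(lam * c) + -lam * (Real.pi * r ^ 2 - Jdisk β r z u)) := by
    rw [muIntegrand, Real.exp_add]
    ring
  have h4 : 2 * Real.exp (-(lam * c / 2)) * nearestDensity (lam / 2) r =
      2 * Real.pi * lam * r * Real.exp (-(lam * c / 2) + -(lam / 2 * Real.pi) * r ^ 2) := by
    rw [nearestDensity, Real.exp_add]
    ring
  rw [h3, h4]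
  refine mul_le_mul_of_nonneg_left (Real.exp_le_exp.2 ?_) (by positivity)
  have h5 := mul_le_mul_of_nonneg_left (add_le_add h1 h2) hlam.le
  linarith

lemma tauIntegrand_eq (lam β σ u z : ℝ) : tauIntegrand lam β σ u z =
    1 / z * Real.exp (-σ ^ 2 * z) *
      (Real.exp (-(lam * thinningMass β z)) * (mu lam β z u - 1)) := by
  rw [tauIntegrand, thinningMass, sub_eq_add_neg (-σ ^ 2 * z), Real.exp_add,
    show Real.pi * lam * Kβ β * z ^ (2 / β) = lam * (Real.pi * Kβ β * z ^ (2 / β)) by ring]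
  ring

lemma tauIntegrand_nonneg (σ : ℝ) (hlam : 0 < lam) (hβ : 2 < β) (hz : 0 < z) (hu : 0 ≤ u) :
    0 ≤ tauIntegrand lam β σ u z := by
  have := sub_nonneg.2 (one_le_mu hlam hβ hz hu)
  rw [tauIntegrand_eq]
  positivity

/-- An integrable bound for the integrand of `τ`, uniform in `u` and `σ`. -/
noncomputable def tauBound (lam β z : ℝ) : ℝ :=
  2 * lam * (Real.pi * Kβ β) *
    (z ^ (2 / β - 1) * Real.exp (-(lam * (Real.pi * Kβ β) / 2) * z ^ (2 / β)))

lemma tauIntegrand_le (σ : ℝ) (hlam : 0 < lam) (hβ : 2 < β) (hz : 0 < z) (hu : 0 ≤ u) :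
    tauIntegrand lam β σ u z ≤ tauBound lam β z := by
  have h1 := mu_sub_one_le hlam hβ hz hu
  have h2 := exp_mul_mu_le hlam hβ hz hu
  have hc := thinningMass_nonneg hβ hz
  have hmu := one_le_mu hlam hβ hz hu
  set c := thinningMass β z with hcdef
  have hb : tauBound lam β z = 1 / z * (lam * c * (2 * Real.exp (-(lam * c / 2)))) := by
    rw [tauBound, hcdef, thinningMass, Real.rpow_sub hz, Real.rpow_one]
    ring_nf
  have h3 : Real.exp (-(lam * c)) * (mu lam β z u - 1) ≤
      lam * c * (2 * Real.exp (-(lam * c / 2))) := by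
    calc _ ≤ Real.exp (-(lam * c)) * (lam * c * mu lam β z u) := by gcongr
      _ = lam * c * (Real.exp (-(lam * c)) * mu lam β z u) := by ring
      _ ≤ _ := by gcongr
  have h4 : Real.exp (-σ ^ 2 * z) ≤ 1 := Real.exp_le_one_iff.2 (by nlinarith [sq_nonneg σ])
  rw [tauIntegrand_eq, hb]
  have h5 : 0 ≤ Real.exp (-(lam * c)) * (mu lam β z u - 1) :=
    mul_nonneg (Real.exp_pos _).le (by linarith)
  calc _ ≤ 1 / z * 1 * (Real.exp (-(lam * c)) * (mu lam β z u - 1)) := by gcongr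
    _ ≤ _ := by
        rw [mul_one]
        gcongr

lemma integrableOn_tauBound (hlam : 0 < lam) (hβ : 2 < β) :
    IntegrableOn (tauBound lam β) (Set.Ioi 0) := by
  have hK := Kβ_pos hβ
  have hβ0 : 0 < β := by linarith
  have hs : 0 < 2 / β := by positivity
  exact (integrableOn_rpow_mul_exp_neg_mul_rpow (by linarith) hs (by positivity)).const_mul _

end Bounds

/-! ### The Laplace functional in terms of `μ` -/

/-- The Laplace functional, averaged over the fading, of the interference at `b` when the nearest
point to `a` does not interfere. -/
noncomputable def laplaceBeyond (lam β : ℝ) (a b : Plane) (z : ℝ) : ℝ≥0∞ :=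
  ∫⁻ r in Set.Ioi 0, ENNReal.ofReal (nearestDensity lam r) *
    expNeg (ENNReal.ofReal lam * ∫⁻ x in {x | r < ‖x - a‖}, ENNReal.ofReal (thinning β z b x))

lemma laplaceBeyond_eq {lam β z : ℝ} (hlam : 0 < lam) (hβ : 2 < β) (hz : 0 < z) (a b : Plane) :
    laplaceBeyond lam β a b z =
      ENNReal.ofReal (Real.exp (-(lam * thinningMass β z)) * mu lam β z ‖b - a‖) := by
  set u := ‖b - a‖
  have hu : 0 ≤ u := norm_nonneg _
  have htail : ∀ r, 0 < r → ∫⁻ x in {x | r < ‖x - a‖}, ENNReal.ofReal (thinning β z b x) =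
      ENNReal.ofReal (thinningMass β z - Jdisk β r z u) := by
    intro r hr
    have hcompl : {x | r < ‖x - a‖} = (Metric.closedBall a r)ᶜ := by
      ext x
      simp [dist_eq_norm]
    have hadd := lintegral_add_compl (μ := volume)
      (fun x => ENNReal.ofReal (thinning β z b x))
      (Metric.isClosed_closedBall (x := a) (ε := r)).measurableSet
    rw [← hcompl, lintegral_closedBall_thinning (by linarith) hz a b hr.le,
      lintegral_thinning hβ hz b] at hadd
    rw [ENNReal.ofReal_sub _ (Jdisk_nonneg hz hr.le), thinningMass, ← hadd,
      ENNReal.add_sub_cancel_left ENNReal.ofReal_ne_top]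
  have hint := ((integrableOn_muIntegrand hlam hβ hz hu).const_mul (2 * Real.pi * lam)).const_mul
    (Real.exp (-(lam * thinningMass β z)))
  rw [laplaceBeyond, mu_eq, ← integral_const_mul, ofReal_integral_eq_lintegral_ofReal hint]
  · refine setLIntegral_congr_fun measurableSet_Ioi fun r (hr : 0 < r) => ?_
    have hJ := Jdisk_le_thinningMass hβ hz hu hr.le
    rw [htail r hr, ← ENNReal.ofReal_mul hlam.le,
      expNeg_ofReal (mul_nonneg hlam.le (by linarith)),
      ← ENNReal.ofReal_mul (nearestDensity_nonneg hlam hr.le), mul_muIntegrand_eq,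
      mul_left_comm, ← Real.exp_add]
    ring_nf
  · refine ae_restrict_of_forall_mem measurableSet_Ioi fun r (hr : 0 < r) => ?_
    have := nearestDensity_nonneg hlam hr.le
    simp only [mul_muIntegrand_eq, Pi.zero_apply]
    positivity

lemma laplaceBeyond_le {lam β z : ℝ} (hlam : 0 < lam) (hβ : 2 < β) (hz : 0 < z) (a b : Plane) :
    laplaceBeyond lam β a b z ≤
      ENNReal.ofReal (2 * Real.exp (-(lam * thinningMass β z / 2))) := by
  rw [laplaceBeyond_eq hlam hβ hz]
  exact ENNReal.ofReal_le_ofReal (exp_mul_mu_le hlam hβ hz (norm_nonneg _))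

lemma measurable_laplaceBeyond (lam β : ℝ) :
    Measurable fun p : Plane × ℝ => laplaceBeyond lam β 0 p.1 p.2 := by
  have hset : ∀ r : ℝ, MeasurableSet {x : Plane | r < ‖x - 0‖} := fun r =>
    measurableSet_lt measurable_const (measurable_norm_sub_const 0)
  unfold laplaceBeyond
  simp_rw [← lintegral_indicator (hset _)]
  have h1 : Measurable fun q : ((Plane × ℝ) × ℝ) × Plane =>
      {x : Plane | q.1.2 < ‖x - 0‖}.indicator
        (fun x => ENNReal.ofReal (thinning β q.1.1.2 q.1.1.1 x)) q.2 := by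
    have hS : MeasurableSet {q : ((Plane × ℝ) × ℝ) × Plane | q.1.2 < ‖q.2 - 0‖} :=
      measurableSet_lt (by fun_prop) (by fun_prop)
    have hf : Measurable fun q : ((Plane × ℝ) × ℝ) × Plane =>
        ENNReal.ofReal (thinning β q.1.1.2 q.1.1.1 q.2) := by
      unfold thinning
      fun_prop
    exact hf.indicator hS
  have h2 : Measurable fun q : (Plane × ℝ) × ℝ => ENNReal.ofReal (nearestDensity lam q.2) *
      expNeg (ENNReal.ofReal lam * ∫⁻ x : Plane, {x : Plane | q.2 < ‖x - 0‖}.indicator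
        (fun x => ENNReal.ofReal (thinning β q.1.2 q.1.1 x)) x) := by
    have hd := (continuous_nearestDensity lam).measurable
    exact (hd.comp measurable_snd).ennreal_ofReal.mul
      (measurable_expNeg.comp (h1.lintegral_prod_right'.const_mul _))
  exact h2.lintegral_prod_right'

/-- A jointly measurable function of `u` and `z` that equals the integrand of `τ` in the range of
integration. -/
lemma exists_measurable_tauIntegrand {lam β : ℝ} (σ : ℝ) (hlam : 0 < lam) (hβ : 2 < β) :
    ∃ g : ℝ × ℝ → ℝ, Measurable g ∧ ∀ u z, 0 ≤ u → 0 < z → g (u, z) = tauIntegrand lam β σ u z := by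
  let L : ℝ × ℝ → ℝ := fun p =>
    (laplaceBeyond lam β 0 (EuclideanSpace.single 0 p.1 : Plane) p.2).toReal
  have hsingle : Continuous fun u : ℝ => (EuclideanSpace.single 0 u : Plane) := by
    have : (fun u : ℝ => (EuclideanSpace.single 0 u : Plane)) =
        fun u => u • EuclideanSpace.single 0 1 := by
      ext u i
      simp
    rw [this]
    fun_prop
  have hL : Measurable L := by
    have : Measurable fun p : ℝ × ℝ => ((EuclideanSpace.single 0 p.1 : Plane), p.2) :=
      (hsingle.measurable.comp measurable_fst).prodMk measurable_snd
    exact ((measurable_laplaceBeyond lam β).comp this).ennreal_toReal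
  refine ⟨fun p => 1 / p.2 * Real.exp (-σ ^ 2 * p.2) *
    (L p - Real.exp (-(lam * thinningMass β p.2))), ?_, ?_⟩
  · unfold thinningMass
    fun_prop
  · intro u z hu hz
    have hmu := one_le_mu hlam hβ hz hu
    have hLz : L (u, z) = Real.exp (-(lam * thinningMass β z)) * mu lam β z u := by
      simp only [L]
      rw [laplaceBeyond_eq hlam hβ hz, sub_zero, norm_single_plane hu,
        ENNReal.toReal_ofReal (by positivity)]
    rw [tauIntegrand_eq]
    simp only [hLz]
    ring

lemma integrableOn_tauIntegrand {lam β u : ℝ} (σ : ℝ) (hlam : 0 < lam) (hβ : 2 < β) (hu : 0 ≤ u) :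
    IntegrableOn (tauIntegrand lam β σ u) (Set.Ioi 0) := by
  obtain ⟨g, hg, hgτ⟩ := exists_measurable_tauIntegrand σ hlam hβ
  have hmeas : AEStronglyMeasurable (tauIntegrand lam β σ u) (volume.restrict (Set.Ioi 0)) :=
    (hg.comp (measurable_const.prodMk measurable_id)).aestronglyMeasurable.congr
      (ae_restrict_of_forall_mem measurableSet_Ioi fun z hz => hgτ u z hu hz)
  refine (integrableOn_tauBound hlam hβ).mono' hmeas
    (ae_restrict_of_forall_mem measurableSet_Ioi fun z (hz : 0 < z) => ?_)
  rw [Real.norm_of_nonneg (tauIntegrand_nonneg σ hlam hβ hz hu)]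
  exact tauIntegrand_le σ hlam hβ hz hu

lemma tau_nonneg {lam β u : ℝ} (σ : ℝ) (hlam : 0 < lam) (hβ : 2 < β) (hu : 0 ≤ u) :
    0 ≤ tau lam β σ u :=
  setIntegral_nonneg measurableSet_Ioi fun _ hz => tauIntegrand_nonneg σ hlam hβ hz hu

lemma tau_le {lam β u : ℝ} (σ : ℝ) (hlam : 0 < lam) (hβ : 2 < β) (hu : 0 ≤ u) :
    tau lam β σ u ≤ ∫ z in Set.Ioi 0, tauBound lam β z :=
  setIntegral_mono_on (integrableOn_tauIntegrand σ hlam hβ hu) (integrableOn_tauBound hlam hβ)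
    measurableSet_Ioi fun _ hz => tauIntegrand_le σ hlam hβ hz hu

lemma exists_measurable_tau {lam β : ℝ} (σ : ℝ) (hlam : 0 < lam) (hβ : 2 < β) :
    ∃ g : ℝ → ℝ, Measurable g ∧ ∀ u, 0 ≤ u → g u = tau lam β σ u := by
  obtain ⟨g, hg, hgτ⟩ := exists_measurable_tauIntegrand σ hlam hβ
  refine ⟨fun u => ∫ z in Set.Ioi 0, g (u, z),
    hg.stronglyMeasurable.integral_prod_right'.measurable, fun u hu => ?_⟩
  exact setIntegral_congr_fun measurableSet_Ioi fun z hz => hgτ u z hu hz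

lemma ofReal_tau {lam β : ℝ} (σ : ℝ) (hlam : 0 < lam) (hβ : 2 < β) (a b : Plane) :
    ENNReal.ofReal (tau lam β σ ‖b - a‖) =
      ∫⁻ z in Set.Ioi 0, ENNReal.ofReal (1 / z * Real.exp (-σ ^ 2 * z)) *
        (laplaceBeyond lam β a b z - ENNReal.ofReal (Real.exp (-(lam * thinningMass β z)))) := by
  have hu : 0 ≤ ‖b - a‖ := norm_nonneg _
  rw [tau, ofReal_integral_eq_lintegral_ofReal (integrableOn_tauIntegrand σ hlam hβ hu)
    (ae_restrict_of_forall_mem measurableSet_Ioi fun z hz =>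
      tauIntegrand_nonneg σ hlam hβ hz hu)]
  refine setLIntegral_congr_fun measurableSet_Ioi fun z (hz : 0 < z) => ?_
  rw [laplaceBeyond_eq hlam hβ hz, ← ENNReal.ofReal_sub _ (Real.exp_pos _).le,
    ← ENNReal.ofReal_mul (by positivity), tauIntegrand_eq]
  congr 1
  ring

/-! ### Averaging over the fading -/

lemma lintegral_expMeasure_one {f : ℝ → ℝ≥0∞} (hf : Measurable f) :
    ∫⁻ h, f h ∂expMeasure 1 = ∫⁻ h in Set.Ioi 0, ENNReal.ofReal (Real.exp (-h)) * f h := by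
  have hpdf : Measurable (gammaPDF 1 1) := (measurable_gammaPDFReal 1 1).ennreal_ofReal
  rw [expMeasure, gammaMeasure, lintegral_withDensity_eq_lintegral_mul _ hpdf hf,
    setLIntegral_congr Ioi_ae_eq_Ici, ← lintegral_indicator measurableSet_Ici]
  refine lintegral_congr fun h => ?_
  by_cases hh : 0 ≤ h
  · have : exponentialPDF 1 h = ENNReal.ofReal (Real.exp (-h)) := by
      rw [exponentialPDF_of_nonneg hh]
      simp
    rw [Set.indicator_of_mem (by exact hh), Pi.mul_apply, ← this]
    rfl
  · rw [Set.indicator_of_notMem (by exact hh), Pi.mul_apply, gammaPDF_of_neg (not_le.1 hh),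
      zero_mul]

lemma expNeg_log_one_add {y : ℝ} (hy : 0 ≤ y) :
    expNeg (ENNReal.ofReal (Real.log (1 + y))) = ENNReal.ofReal (1 + y)⁻¹ := by
  rw [expNeg_ofReal (Real.log_nonneg (by linarith)), Real.exp_neg, Real.exp_log (by linarith)]

/-- The Laplace transform of the exponential distribution. -/
lemma lintegral_expNeg_expMeasure {z p : ℝ} (hz : 0 ≤ z) (hp : 0 ≤ p) :
    ∫⁻ h, expNeg (ENNReal.ofReal z * ENNReal.ofReal (h * p)) ∂expMeasure 1 =
      expNeg (ENNReal.ofReal (Real.log (1 + z * p))) := by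
  have hzp : 0 ≤ z * p := mul_nonneg hz hp
  have hm : Measurable fun h : ℝ => expNeg (ENNReal.ofReal z * ENNReal.ofReal (h * p)) :=
    measurable_expNeg.comp (by fun_prop)
  rw [lintegral_expMeasure_one hm, expNeg_log_one_add hzp,
    ← lintegral_exp_neg_mul (by linarith)]
  refine setLIntegral_congr_fun measurableSet_Ioi fun h (hh : 0 < h) => ?_
  rw [← ENNReal.ofReal_mul hz, expNeg_ofReal (by positivity),
    ← ENNReal.ofReal_mul (Real.exp_pos _).le, ← Real.exp_add]
  ring_nf

/-- The Laplace transform of a weighted sum of independent exponential variables. -/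
lemma lintegral_expNeg_tsum_fading {Ω : Type*} [MeasurableSpace Ω] {P : Measure Ω}
    [IsProbabilityMeasure P] {h : ℕ → Ω → ℝ} (hmeas : ∀ j, Measurable (h j))
    (hlaw : ∀ j, P.map (h j) = expMeasure 1) (hindep : iIndepFun h P) {z : ℝ} (hz : 0 ≤ z)
    {p : ℕ → ℝ} (hp : ∀ j, 0 ≤ p j) :
    ∫⁻ ω, expNeg (ENNReal.ofReal z * ∑' j, ENNReal.ofReal (h j ω * p j)) ∂P =
      expNeg (∑' j, ENNReal.ofReal (Real.log (1 + z * p j))) := by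
  have hg : ∀ j, Measurable fun y : ℝ => expNeg (ENNReal.ofReal z * ENNReal.ofReal (y * p j)) :=
    fun j => measurable_expNeg.comp (by fun_prop)
  have hfin : ∀ n, ∫⁻ ω, expNeg (∑ j ∈ Finset.range n,
      ENNReal.ofReal z * ENNReal.ofReal (h j ω * p j)) ∂P =
      expNeg (∑ j ∈ Finset.range n, ENNReal.ofReal (Real.log (1 + z * p j))) := by
    intro n
    simp_rw [expNeg_sum]
    have := lintegral_prod_eq_prod_lintegral_of_indepFun (Finset.range n) _ (hindep.comp _ hg)
      (fun j => (hg j).comp (hmeas j))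
    refine this.trans (Finset.prod_congr rfl fun j _ => ?_)
    rw [← lintegral_expNeg_expMeasure hz (hp j), ← hlaw j, lintegral_map (hg j) (hmeas j)]
    rfl
  have hL : Tendsto (fun n => ∫⁻ ω, expNeg (∑ j ∈ Finset.range n,
      ENNReal.ofReal z * ENNReal.ofReal (h j ω * p j)) ∂P) atTop
      (𝓝 (∫⁻ ω, expNeg (ENNReal.ofReal z * ∑' j, ENNReal.ofReal (h j ω * p j)) ∂P)) := by
    refine tendsto_lintegral_of_dominated_convergence (fun _ => 1) (fun n => ?_)
      (fun n => ae_of_all _ fun ω => expNeg_le_one _) (by simp) (ae_of_all _ fun ω => ?_)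
    · exact measurable_expNeg.comp (by fun_prop)
    · rw [← ENNReal.tsum_mul_left]
      exact (continuous_expNeg.tendsto _).comp (ENNReal.tendsto_nat_tsum _)
  refine tendsto_nhds_unique hL ?_
  simp_rw [hfin]
  exact (continuous_expNeg.tendsto _).comp (ENNReal.tendsto_nat_tsum _)

/-! ### The rate as a mixture of exponentials of the interference -/

/-- A Frullani integral. -/
lemma ofReal_log_one_add_div {N S : ℝ} (hN : 0 < N) (hS : 0 ≤ S) :
    ENNReal.ofReal (Real.log (1 + S / N)) =
      ∫⁻ z in Set.Ioi 0,
        ENNReal.ofReal (1 / z * (Real.exp (-(N * z)) - Real.exp (-((N + S) * z)))) := by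
  have hle : N ≤ N + S := by linarith
  have hpos : ∀ y ∈ Set.Ioc N (N + S), 0 < y := fun y hy => hN.trans hy.1
  have h0 : (0 : ℝ) ∉ Set.uIcc N (N + S) := by
    rw [Set.uIcc_of_le hle]
    exact fun h => absurd h.1 (not_le.2 hN)
  have hlog : Real.log (1 + S / N) = ∫ y in Set.Ioc N (N + S), y⁻¹ := by
    rw [← intervalIntegral.integral_of_le hle, integral_inv h0]
    congr 1
    field_simp
  have hint : IntegrableOn (fun y : ℝ => y⁻¹) (Set.Ioc N (N + S)) := by
    have := intervalIntegral.intervalIntegrable_inv (μ := volume) (f := fun x : ℝ => x) (a := N)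
      (b := N + S) (fun x hx h => h0 (h ▸ hx)) continuousOn_id
    rwa [intervalIntegrable_iff_integrableOn_Ioc_of_le hle] at this
  rw [hlog, ofReal_integral_eq_lintegral_ofReal hint
    (ae_restrict_of_forall_mem measurableSet_Ioc fun y hy => (inv_pos.2 (hpos y hy)).le),
    setLIntegral_congr_fun measurableSet_Ioc fun y hy => (lintegral_exp_neg_mul (hpos y hy)).symm,
    lintegral_lintegral_swap (by fun_prop)]
  refine setLIntegral_congr_fun measurableSet_Ioi fun z (hz : 0 < z) => ?_
  have hexp : ∫ y in N..N + S, Real.exp (-y * z) =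
      1 / z * (Real.exp (-(N * z)) - Real.exp (-((N + S) * z))) := by
    have hder : ∀ y ∈ Set.uIcc N (N + S), HasDerivAt (fun y => -(1 / z) * Real.exp (-y * z))
        (Real.exp (-y * z)) y := by
      intro y _
      have := (((hasDerivAt_id y).neg.mul_const z).exp).const_mul (-(1 / z))
      convert! this using 1
      field_simp
      simp [mul_comm]
    rw [intervalIntegral.integral_eq_sub_of_hasDerivAt hder
      ((by fun_prop : Continuous fun y => Real.exp (-y * z)).intervalIntegrable _ _)]
    ring_nf
  rw [← hexp, intervalIntegral.integral_of_le hle, ofReal_integral_eq_lintegral_ofReal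
    (by fun_prop : Continuous fun y => Real.exp (-y * z)).integrableOn_Ioc
    (ae_of_all _ fun y => (Real.exp_pos _).le)]

section Rate

variable (β σ : ℝ) (x : ℕ → Plane) (h : ℕ → ℝ) (a b : Plane)

/-- The total power received at `b`, with values in `[0, ∞]`. -/
noncomputable def totalPower : ℝ≥0∞ := ∑' j, ENNReal.ofReal (receivedPower β x h b j)

/-- The interference at `b` when served by station `i`, with values in `[0, ∞]`. -/
noncomputable def totalInterference (i : ℕ) : ℝ≥0∞ :=
  ∑' j, if j = i then 0 else ENNReal.ofReal (receivedPower β x h b j)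

/-- The rate at `b` when served by the station nearest to `a`, as an integral of exponentials of
the received powers. Unlike `dataRate` it treats an infinite interference correctly and is
jointly measurable by construction; the two agree almost surely. -/
noncomputable def mixedRate : ℝ≥0∞ :=
  ∫⁻ z in Set.Ioi 0, ENNReal.ofReal (1 / z * Real.exp (-σ ^ 2 * z)) *
    (expNeg (ENNReal.ofReal z * totalInterference β x h b (nearestIndex x a)) -
      expNeg (ENNReal.ofReal z * totalPower β x h b))

variable {β σ x h a b}

lemma totalPower_eq_add (i : ℕ) : totalPower β x h b =
    ENNReal.ofReal (receivedPower β x h b i) + totalInterference β x h b i := by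
  convert! ENNReal.tsum_eq_add_tsum_ite
    (f := fun j => ENNReal.ofReal (receivedPower β x h b j)) i
  exact tsum_congr fun j => by split_ifs <;> rfl

lemma receivedPower_nonneg (hh : ∀ j, 0 ≤ h j) (j : ℕ) : 0 ≤ receivedPower β x h b j :=
  mul_nonneg (hh j) (Real.rpow_nonneg (norm_nonneg _) _)

lemma summable_receivedPower (hh : ∀ j, 0 ≤ h j) (hfin : totalPower β x h b ≠ ∞) :
    Summable fun j => receivedPower β x h b j := by
  refine (ENNReal.summable_toReal hfin).congr fun j => ?_
  exact ENNReal.toReal_ofReal (receivedPower_nonneg hh j)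

lemma interference_eq_toReal (hh : ∀ j, 0 ≤ h j) (i : ℕ) :
    interference β x h b i = (totalInterference β x h b i).toReal := by
  have h1 : totalInterference β x h b i =
      ∑' j : {j : ℕ // j ≠ i}, ENNReal.ofReal (receivedPower β x h b j) := by
    have := tsum_subtype {j : ℕ | j ≠ i} fun j => ENNReal.ofReal (receivedPower β x h b j)
    refine Eq.trans (tsum_congr fun j => ?_) this.symm
    by_cases hj : j = i <;> simp [hj]
  rw [h1, ENNReal.tsum_toReal_eq fun _ => ENNReal.ofReal_ne_top]
  refine tsum_congr fun j => ?_
  exact (ENNReal.toReal_ofReal (receivedPower_nonneg hh j)).symm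

lemma dataRate_nonneg (hh : ∀ j, 0 ≤ h j) (i : ℕ) : 0 ≤ dataRate β σ x h b i := by
  have h1 := receivedPower_nonneg (β := β) (x := x) (b := b) hh i
  have h2 : 0 ≤ interference β x h b i := by
    rw [interference_eq_toReal hh]
    exact ENNReal.toReal_nonneg
  have h3 : 0 ≤ sinr β σ x h b i := by
    unfold sinr
    positivity
  exact Real.log_nonneg (by linarith)

lemma ofReal_dataRate (hh : ∀ j, 0 ≤ h j) (hfin : totalPower β x h b ≠ ∞)
    (hpos : totalInterference β x h b (nearestIndex x a) ≠ 0) :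
    ENNReal.ofReal (dataRate β σ x h b (nearestIndex x a)) = mixedRate β σ x h a b := by
  set i := nearestIndex x a with hi
  have hI : totalInterference β x h b i ≠ ∞ := by
    rw [totalPower_eq_add i] at hfin
    exact (ENNReal.add_ne_top.1 hfin).2
  set I := (totalInterference β x h b i).toReal with hIdef
  have hI0 : 0 < I := ENNReal.toReal_pos hpos hI
  have hIe : totalInterference β x h b i = ENNReal.ofReal I := (ENNReal.ofReal_toReal hI).symm
  have hS := receivedPower_nonneg (β := β) (x := x) (b := b) hh i
  rw [dataRate, sinr, interference_eq_toReal hh, ← hIdef,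
    ofReal_log_one_add_div (by positivity) hS, mixedRate, ← hi]
  refine setLIntegral_congr_fun measurableSet_Ioi fun z (hz : 0 < z) => ?_
  rw [totalPower_eq_add i, hIe, ← ENNReal.ofReal_add hS hI0.le, ← ENNReal.ofReal_mul hz.le,
    ← ENNReal.ofReal_mul hz.le, expNeg_ofReal (by positivity), expNeg_ofReal (by positivity),
    ← ENNReal.ofReal_sub _ (Real.exp_pos _).le, ← ENNReal.ofReal_mul (by positivity), mul_assoc,
    mul_sub (Real.exp _), ← Real.exp_add, ← Real.exp_add]
  ring_nf

end Rate

section Measurability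

variable {α : Type*} [MeasurableSpace α] {x : α → ℕ → Plane} {h : α → ℕ → ℝ} {a b : α → Plane}

lemma measurable_nearestIndex (hx : Measurable x) (ha : Measurable a) :
    Measurable fun ω => nearestIndex (x ω) (a ω) := by
  have hx' : ∀ i, Measurable fun ω => x ω i := fun i => (measurable_pi_apply i).comp hx
  have hS : ∀ i, MeasurableSet {ω | ∀ j, ‖x ω i - a ω‖ ≤ ‖x ω j - a ω‖} := by
    intro i
    rw [Set.ofPred_forall]
    exact MeasurableSet.iInter fun j =>
      measurableSet_le ((hx' i).sub ha).norm ((hx' j).sub ha).norm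
  refine measurable_of_Iic fun n => ?_
  have hset : (fun ω => nearestIndex (x ω) (a ω)) ⁻¹' Set.Iic n =
      (⋃ i ∈ Set.Iic n, {ω | ∀ j, ‖x ω i - a ω‖ ≤ ‖x ω j - a ω‖}) ∪
        ⋂ i, {ω | ∀ j, ‖x ω i - a ω‖ ≤ ‖x ω j - a ω‖}ᶜ := by
    ext ω
    set S : Set ℕ := {i | ∀ j, ‖x ω i - a ω‖ ≤ ‖x ω j - a ω‖} with hSdef
    have h1 : (ω ∈ (fun ω => nearestIndex (x ω) (a ω)) ⁻¹' Set.Iic n) ↔ sInf S ≤ n := Iff.rfl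
    have h2 : (ω ∈ (⋃ i ∈ Set.Iic n, {ω | ∀ j, ‖x ω i - a ω‖ ≤ ‖x ω j - a ω‖}) ∪
        ⋂ i, {ω | ∀ j, ‖x ω i - a ω‖ ≤ ‖x ω j - a ω‖}ᶜ) ↔
        (∃ i, i ≤ n ∧ i ∈ S) ∨ ∀ i, i ∉ S := by
      simp [S]
    rw [h1, h2]
    constructor
    · intro hle
      by_cases hne : S.Nonempty
      · exact Or.inl ⟨_, hle, Nat.sInf_mem hne⟩
      · exact Or.inr fun i hi => hne ⟨i, hi⟩
    · rintro (⟨i, hin, hi⟩ | hno)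
      · exact (Nat.sInf_le hi).trans hin
      · have : S = ∅ := Set.eq_empty_iff_forall_notMem.2 hno
        simp [this]
  rw [hset]
  exact (MeasurableSet.biUnion (Set.to_countable _) fun i _ => hS i).union
    (MeasurableSet.iInter fun i => (hS i).compl)

lemma measurable_receivedPower (β : ℝ) (hx : Measurable x) (hh : Measurable h)
    (hb : Measurable b) (j : ℕ) :
    Measurable fun ω => ENNReal.ofReal (receivedPower β (x ω) (h ω) (b ω) j) := by
  have hx' : Measurable fun ω => x ω j := (measurable_pi_apply j).comp hx
  have hh' : Measurable fun ω => h ω j := (measurable_pi_apply j).comp hh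
  unfold receivedPower
  fun_prop

lemma measurable_totalPower (β : ℝ) (hx : Measurable x) (hh : Measurable h) (hb : Measurable b) :
    Measurable fun ω => totalPower β (x ω) (h ω) (b ω) :=
  Measurable.tsum fun j => measurable_receivedPower β hx hh hb j

lemma measurable_totalInterference (β : ℝ) (hx : Measurable x) (hh : Measurable h)
    (ha : Measurable a) (hb : Measurable b) :
    Measurable fun ω => totalInterference β (x ω) (h ω) (b ω) (nearestIndex (x ω) (a ω)) := by
  have h1 : Measurable fun p : ℕ × α => totalInterference β (x p.2) (h p.2) (b p.2) p.1 := by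
    refine measurable_from_prod_countable_right fun i => Measurable.tsum fun j => ?_
    by_cases hj : j = i
    · simp [hj]
    · simpa [hj] using measurable_receivedPower β hx hh hb j
  exact h1.comp ((measurable_nearestIndex hx ha).prodMk measurable_id)

lemma measurable_mixedRate_integrand (β σ : ℝ) {z : α → ℝ} (hx : Measurable x)
    (hh : Measurable h) (ha : Measurable a) (hb : Measurable b) (hz : Measurable z) :
    Measurable fun ω => ENNReal.ofReal (1 / z ω * Real.exp (-σ ^ 2 * z ω)) *
      (expNeg (ENNReal.ofReal (z ω) *
          totalInterference β (x ω) (h ω) (b ω) (nearestIndex (x ω) (a ω))) -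
        expNeg (ENNReal.ofReal (z ω) * totalPower β (x ω) (h ω) (b ω))) := by
  have h1 := measurable_totalInterference β hx hh ha hb
  have h2 := measurable_totalPower β hx hh hb
  refine Measurable.mul (by fun_prop) (Measurable.sub ?_ ?_)
  · exact measurable_expNeg.comp (hz.ennreal_ofReal.mul h1)
  · exact measurable_expNeg.comp (hz.ennreal_ofReal.mul h2)

lemma measurable_mixedRate (β σ : ℝ) (hx : Measurable x) (hh : Measurable h) (ha : Measurable a)
    (hb : Measurable b) : Measurable fun ω => mixedRate β σ (x ω) (h ω) (a ω) (b ω) := by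
  have := measurable_mixedRate_integrand β σ (α := α × ℝ) (hx.comp measurable_fst)
    (hh.comp measurable_fst) (ha.comp measurable_fst) (hb.comp measurable_fst) measurable_snd
  exact this.lintegral_prod_right'

end Measurability

/-! ### The expected rate at deterministic locations -/

section Expectation

variable {Ω : Type*} [MeasurableSpace Ω] {P : Measure Ω} [IsProbabilityMeasure P] {lam β z : ℝ}
  {X : ℕ → Ω → Plane} {h : ℕ → Ω → ℝ}

/-- Minus the logarithm of the mean of the fading weight `exp (-z H ‖x - b‖ ^ (-β))`. -/
noncomputable def fadingExponent (β z : ℝ) (b x : Plane) : ℝ≥0∞ :=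
  ENNReal.ofReal (Real.log (1 + z * ‖x - b‖ ^ (-β)))

lemma measurable_fadingExponent (β z : ℝ) (b : Plane) : Measurable (fadingExponent β z b) := by
  unfold fadingExponent
  fun_prop

lemma one_sub_expNeg_fadingExponent (hz : 0 < z) {b x : Plane} (hx : x ≠ b) :
    1 - expNeg (fadingExponent β z b x) = ENNReal.ofReal (thinning β z b x) := by
  have hn : 0 < ‖x - b‖ := norm_pos_iff.2 (sub_ne_zero.2 hx)
  have hw : 0 < ‖x - b‖ ^ β := Real.rpow_pos_of_pos hn β
  have hy : 0 ≤ z * ‖x - b‖ ^ (-β) := by positivity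
  rw [fadingExponent, expNeg_log_one_add hy, ← ENNReal.ofReal_one,
    ← ENNReal.ofReal_sub _ (by positivity), thinning, Real.rpow_neg hn.le]
  congr 1
  field_simp
  ring

lemma setLIntegral_one_sub_expNeg_fadingExponent (hz : 0 < z) (b : Plane) (S : Set Plane) :
    ∫⁻ x in S, (1 - expNeg (fadingExponent β z b x)) =
      ∫⁻ x in S, ENNReal.ofReal (thinning β z b x) := by
  refine lintegral_congr_ae (ae_restrict_of_ae ?_)
  filter_upwards [compl_mem_ae_iff.2 (measure_singleton b)] with x hx
  exact one_sub_expNeg_fadingExponent hz hx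

lemma lintegral_expNeg_totalPower (hmeas : ∀ j, Measurable (h j))
    (hlaw : ∀ j, P.map (h j) = expMeasure 1) (hindep : iIndepFun h P) (hz : 0 < z)
    (x : ℕ → Plane) (b : Plane) :
    ∫⁻ ω, expNeg (ENNReal.ofReal z * totalPower β x (fun j => h j ω) b) ∂P =
      expNeg (∑' j, fadingExponent β z b (x j)) :=
  lintegral_expNeg_tsum_fading hmeas hlaw hindep hz.le
    fun _ => Real.rpow_nonneg (norm_nonneg _) _

lemma lintegral_expNeg_totalInterference (hmeas : ∀ j, Measurable (h j))
    (hlaw : ∀ j, P.map (h j) = expMeasure 1) (hindep : iIndepFun h P) (hz : 0 < z)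
    (x : ℕ → Plane) (b : Plane) (i : ℕ) :
    ∫⁻ ω, expNeg (ENNReal.ofReal z * totalInterference β x (fun j => h j ω) b i) ∂P =
      expNeg (∑' j, if j = i then 0 else fadingExponent β z b (x j)) := by
  have := lintegral_expNeg_tsum_fading hmeas hlaw hindep hz.le
    (p := fun j => if j = i then 0 else ‖x j - b‖ ^ (-β))
    (fun j => by split_ifs; exacts [le_rfl, Real.rpow_nonneg (norm_nonneg _) _])
  have h1 : ∀ ω, totalInterference β x (fun j => h j ω) b i =
      ∑' j, ENNReal.ofReal (h j ω * if j = i then 0 else ‖x j - b‖ ^ (-β)) := fun ω =>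
    tsum_congr fun j => by split_ifs <;> simp [receivedPower]
  have h2 : ∀ j, (if j = i then 0 else fadingExponent β z b (x j)) =
      ENNReal.ofReal (Real.log (1 + z * if j = i then 0 else ‖x j - b‖ ^ (-β))) := fun j => by
    split_ifs <;> simp [fadingExponent]
  simp_rw [h1, h2]
  exact this

lemma IsHomogeneousPPP.laplace_totalPower (hX : IsHomogeneousPPP P lam X) (hlam : 0 < lam)
    (hβ : 2 < β) (hmeas : ∀ j, Measurable (h j)) (hlaw : ∀ j, P.map (h j) = expMeasure 1)
    (hindep : iIndepFun h P) (hz : 0 < z) (b : Plane) :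
    ∫⁻ ω, ∫⁻ ω', expNeg (ENNReal.ofReal z *
      totalPower β (fun i => X i ω) (fun j => h j ω') b) ∂P ∂P =
      ENNReal.ofReal (Real.exp (-(lam * thinningMass β z))) := by
  simp_rw [lintegral_expNeg_totalPower hmeas hlaw hindep hz]
  rw [hX.laplace (measurable_fadingExponent β z b), ← setLIntegral_univ,
    setLIntegral_one_sub_expNeg_fadingExponent hz, setLIntegral_univ, lintegral_thinning hβ hz,
    ← thinningMass, ← ENNReal.ofReal_mul hlam.le,
    expNeg_ofReal (mul_nonneg hlam.le (thinningMass_nonneg hβ hz))]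

lemma IsHomogeneousPPP.laplace_totalInterference (hX : IsHomogeneousPPP P lam X)
    (hlam : 0 < lam) (hmeas : ∀ j, Measurable (h j)) (hlaw : ∀ j, P.map (h j) = expMeasure 1)
    (hindep : iIndepFun h P) (hz : 0 < z) (a b : Plane) :
    ∫⁻ ω, ∫⁻ ω', expNeg (ENNReal.ofReal z * totalInterference β (fun i => X i ω)
      (fun j => h j ω') b (nearestIndex (fun i => X i ω) a)) ∂P ∂P =
      laplaceBeyond lam β a b z := by
  simp_rw [lintegral_expNeg_totalInterference hmeas hlaw hindep hz]
  rw [hX.laplace_ne_nearestIndex hlam a (measurable_fadingExponent β z b)]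
  simp_rw [setLIntegral_one_sub_expNeg_fadingExponent hz]
  rfl

/-- The expected rate at `b` when served by the station nearest to `a`. -/
theorem IsHomogeneousPPP.lintegral_mixedRate (hX : IsHomogeneousPPP P lam X) (hlam : 0 < lam)
    (hβ : 2 < β) (σ : ℝ) (hmeas : ∀ j, Measurable (h j))
    (hlaw : ∀ j, P.map (h j) = expMeasure 1) (hindep : iIndepFun h P) (a b : Plane) :
    ∫⁻ ω, ∫⁻ ω', mixedRate β σ (fun i => X i ω) (fun j => h j ω') a b ∂P ∂P =
      ENNReal.ofReal (tau lam β σ ‖b - a‖) := by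
  have hXm : Measurable fun ω i => X i ω := measurable_pi_iff.2 hX.measurable
  have hhm : Measurable fun ω j => h j ω := measurable_pi_iff.2 hmeas
  let F : Ω → Ω → ℝ → ℝ≥0∞ := fun ω ω' z =>
    ENNReal.ofReal (1 / z * Real.exp (-σ ^ 2 * z)) *
    (expNeg (ENNReal.ofReal z * totalInterference β (fun i => X i ω) (fun j => h j ω') b
      (nearestIndex (fun i => X i ω) a)) -
      expNeg (ENNReal.ofReal z * totalPower β (fun i => X i ω) (fun j => h j ω') b))
  have hF : Measurable fun p : (Ω × ℝ) × Ω => F p.1.1 p.2 p.1.2 :=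
    measurable_mixedRate_integrand β σ (α := (Ω × ℝ) × Ω)
      (hXm.comp (measurable_fst.comp measurable_fst)) (hhm.comp measurable_snd)
      measurable_const measurable_const (measurable_snd.comp measurable_fst)
  have hF' : ∀ ω, Measurable (Function.uncurry (F ω)) := fun ω =>
    hF.comp ((measurable_const.prodMk measurable_snd).prodMk measurable_fst)
  have hG : Measurable (Function.uncurry fun ω z => ∫⁻ ω', F ω ω' z ∂P) :=
    hF.lintegral_prod_right'
  have hTm : ∀ z, Measurable fun p : Ω × Ω => expNeg (ENNReal.ofReal z *
      totalPower β (fun i => X i p.1) (fun j => h j p.2) b) := fun z =>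
    measurable_expNeg.comp ((measurable_totalPower β (α := Ω × Ω)
      (hXm.comp measurable_fst) (hhm.comp measurable_snd) measurable_const).const_mul _)
  have hle : ∀ z ω ω', expNeg (ENNReal.ofReal z *
      totalPower β (fun i => X i ω) (fun j => h j ω') b) ≤
      expNeg (ENNReal.ofReal z * totalInterference β (fun i => X i ω) (fun j => h j ω') b
        (nearestIndex (fun i => X i ω) a)) := by
    intro z ω ω'
    refine expNeg_antitone ?_
    gcongr
    rw [totalPower_eq_add (nearestIndex (fun i => X i ω) a)]
    exact le_add_self
  have hbound : ∀ f : Ω → ℝ≥0∞, (∀ ω, f ω ≤ 1) → ∫⁻ ω, f ω ∂P ≤ 1 := fun f hf =>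
    (lintegral_mono hf).trans (by simp)
  have hone : ∀ {y : ℝ≥0∞}, y ≤ 1 → y ≠ ∞ := fun hy => (hy.trans_lt (by simp)).ne
  have h1 : ∀ ω, ∫⁻ ω', mixedRate β σ (fun i => X i ω) (fun j => h j ω') a b ∂P =
      ∫⁻ z in Set.Ioi 0, ∫⁻ ω', F ω ω' z ∂P := fun ω =>
    lintegral_lintegral_swap (hF' ω).aemeasurable
  simp_rw [h1]
  rw [lintegral_lintegral_swap hG.aemeasurable, ofReal_tau σ hlam hβ]
  refine setLIntegral_congr_fun measurableSet_Ioi fun z (hz : 0 < z) => ?_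
  have h2 : ∀ ω, ∫⁻ ω', F ω ω' z ∂P = ENNReal.ofReal (1 / z * Real.exp (-σ ^ 2 * z)) *
      (∫⁻ ω', expNeg (ENNReal.ofReal z * totalInterference β (fun i => X i ω)
        (fun j => h j ω') b (nearestIndex (fun i => X i ω) a)) ∂P -
      ∫⁻ ω', expNeg (ENNReal.ofReal z *
        totalPower β (fun i => X i ω) (fun j => h j ω') b) ∂P) := by
    intro ω
    have hTω : Measurable fun ω' => expNeg (ENNReal.ofReal z *
        totalPower β (fun i => X i ω) (fun j => h j ω') b) :=
      measurable_expNeg.comp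
        ((measurable_totalPower β measurable_const hhm measurable_const).const_mul _)
    rw [lintegral_const_mul' _ _ ENNReal.ofReal_ne_top,
      lintegral_sub hTω (hone (hbound _ fun _ => expNeg_le_one _)) (ae_of_all _ (hle z ω))]
  simp_rw [h2]
  rw [lintegral_const_mul' _ _ ENNReal.ofReal_ne_top, lintegral_sub (hTm z).lintegral_prod_right'
    (hone (hbound _ fun _ => hbound _ fun _ => expNeg_le_one _))
    (ae_of_all _ fun ω => lintegral_mono (hle z ω)),
    hX.laplace_totalPower hlam hβ hmeas hlaw hindep hz,
    hX.laplace_totalInterference hlam hmeas hlaw hindep hz]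

end Expectation

/-! ### Independent motion -/

lemma lintegral_comp_of_indepFun {Ω α γ : Type*} [MeasurableSpace Ω] [MeasurableSpace α]
    [MeasurableSpace γ] {P : Measure Ω} [IsProbabilityMeasure P] {A : Ω → α} {C : Ω → γ}
    (hA : Measurable A) (hC : Measurable C) (hind : IndepFun A C P) {F : α × γ → ℝ≥0∞}
    (hF : Measurable F) : ∫⁻ ω, F (A ω, C ω) ∂P = ∫⁻ ω', ∫⁻ ω, F (A ω, C ω') ∂P ∂P := by
  have hmap := (indepFun_iff_map_prod_eq_prod_map_map hA.aemeasurable hC.aemeasurable).1 hind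
  have := Measure.isProbabilityMeasure_map (μ := P) hA.aemeasurable
  have := Measure.isProbabilityMeasure_map (μ := P) hC.aemeasurable
  rw [← lintegral_map hF (hA.prodMk hC), hmap, lintegral_prod_symm _ hF.aemeasurable,
    lintegral_map hF.lintegral_prod_left' hC]
  refine lintegral_congr fun ω' => ?_
  have hF' : Measurable fun x => F (x, C ω') := hF.comp measurable_prodMk_right
  rw [lintegral_map hF' hA]

lemma lintegral_comp_of_indepFun₃ {Ω α γ δ : Type*} [MeasurableSpace Ω] [MeasurableSpace α]
    [MeasurableSpace γ] [MeasurableSpace δ] {P : Measure Ω} [IsProbabilityMeasure P] {A : Ω → α}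
    {B : Ω → γ} {C : Ω → δ} (hA : Measurable A) (hB : Measurable B) (hC : Measurable C)
    (hAB : IndepFun A B P) (hABC : IndepFun (fun ω => (A ω, B ω)) C P)
    {F : (α × γ) × δ → ℝ≥0∞} (hF : Measurable F) :
    ∫⁻ ω, F ((A ω, B ω), C ω) ∂P =
      ∫⁻ ω'', ∫⁻ ω, ∫⁻ ω', F ((A ω, B ω'), C ω'') ∂P ∂P ∂P := by
  rw [lintegral_comp_of_indepFun (hA.prodMk hB) hC hABC hF]
  refine lintegral_congr fun ω'' => ?_
  have hF' : Measurable fun p : α × γ => F (p, C ω'') := hF.comp measurable_prodMk_right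
  rw [lintegral_comp_of_indepFun hA hB hAB hF', lintegral_lintegral_swap]
  exact (hF'.comp ((hA.comp measurable_snd).prodMk (hB.comp measurable_fst))).aemeasurable

lemma measurable_position {α : Type*} [MeasurableSpace α] {y : α → ℕ → Plane} (hy : Measurable y)
    (s t : ℕ) : Measurable fun ω => position s (y ω) t := by
  have hy' : ∀ k, Measurable fun ω => y ω k := fun k => (measurable_pi_apply k).comp hy
  unfold position
  fun_prop

lemma norm_position_sub {s : ℕ} (hs : 1 ≤ s) (y : ℕ → Plane) (t : ℕ) :
    ‖position s y t - position s y (s * (t / s))‖ = (t % s : ℕ) * (‖y (t / s)‖ / s) := by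
  have h1 : s * (t / s) / s = t / s := Nat.mul_div_cancel_left _ hs
  have h2 : s * (t / s) % s = 0 := Nat.mul_mod_right _ _
  rw [position, position, h1, h2]
  simp only [Nat.cast_zero, zero_div, zero_smul, add_zero, add_sub_cancel_left]
  rw [norm_smul, Real.norm_of_nonneg (by positivity)]
  ring

/-- The Cesàro means of a periodic sequence converge to its mean over one period. -/
lemma tendsto_mean_periodic (c : ℕ → ℝ) {s : ℕ} (hs : 1 ≤ s) :
    Tendsto (fun m : ℕ => 1 / (m : ℝ) * ∑ t ∈ Finset.range m, c (t % s)) atTop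
      (𝓝 (1 / (s : ℝ) * ∑ t ∈ Finset.range s, c t)) := by
  set A := 1 / (s : ℝ) * ∑ t ∈ Finset.range s, c t with hA
  have hs0 : (s : ℝ) ≠ 0 := by
    have : s ≠ 0 := by omega
    exact_mod_cast this
  -- the centred partial sums are periodic, hence bounded
  let S : ℕ → ℝ := fun m => ∑ t ∈ Finset.range m, (c (t % s) - A)
  have hSs : S s = 0 := by
    have : ∑ t ∈ Finset.range s, c (t % s) = ∑ t ∈ Finset.range s, c t :=
      Finset.sum_congr rfl fun t ht => by rw [Nat.mod_eq_of_lt (Finset.mem_range.1 ht)]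
    simp only [S, Finset.sum_sub_distrib, this, Finset.sum_const, Finset.card_range, nsmul_eq_mul]
    rw [hA]
    field_simp
    simp
  have hper : Function.Periodic S s := by
    intro m
    simp only [S]
    rw [add_comm m s, Finset.sum_range_add]
    simp only [Nat.add_mod_left]
    change S s + S m = S m
    rw [hSs, zero_add]
  have hbd : ∀ m, ‖S m‖ ≤ ∑ k ∈ Finset.range s, ‖S k‖ := by
    intro m
    rw [← hper.map_mod_nat m]
    exact Finset.single_le_sum (f := fun k => ‖S k‖) (fun k _ => norm_nonneg _)
      (Finset.mem_range.2 (Nat.mod_lt m hs))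
  have hlim : Tendsto (fun m : ℕ => S m * (1 / (m : ℝ))) atTop (𝓝 0) := by
    refine squeeze_zero_norm (a := fun m : ℕ => (∑ k ∈ Finset.range s, ‖S k‖) * (1 / (m : ℝ)))
      (fun m => ?_) ?_
    · rw [norm_mul, Real.norm_of_nonneg (by positivity : 0 ≤ 1 / (m : ℝ))]
      gcongr
      exact hbd m
    · simpa using tendsto_one_div_atTop_nhds_zero_nat.const_mul (∑ k ∈ Finset.range s, ‖S k‖)
  have hsum : Tendsto (fun m : ℕ => A + S m * (1 / (m : ℝ))) atTop (𝓝 A) := by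
    simpa using hlim.const_add A
  refine hsum.congr' ?_
  filter_upwards [eventually_gt_atTop 0] with m hm
  have hm0 : (m : ℝ) ≠ 0 := by positivity
  simp only [S, Finset.sum_sub_distrib, Finset.sum_const, Finset.card_range, nsmul_eq_mul]
  field_simp
  ring

/-! ### The expected rate at random locations -/

lemma ae_fading_nonneg {Ω : Type*} [MeasurableSpace Ω] {P : Measure Ω} {h : ℕ → Ω → ℝ}
    (hmeas : ∀ j, Measurable (h j)) (hlaw : ∀ j, P.map (h j) = expMeasure 1) :
    ∀ᵐ ω ∂P, ∀ j, 0 ≤ h j ω := by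
  refine ae_all_iff.2 fun j => ?_
  have hneg : ∀ᵐ y ∂P.map (h j), 0 ≤ y := by
    rw [hlaw, ae_iff, ← lintegral_indicator_one (by measurability),
      lintegral_expMeasure_one (measurable_one.indicator (by measurability))]
    refine (setLIntegral_congr_fun measurableSet_Ioi fun y (hy : 0 < y) => ?_).trans
      (lintegral_zero (μ := volume.restrict (Set.Ioi (0 : ℝ))))
    simp [hy.le]
  exact ae_of_ae_map (hmeas j).aemeasurable hneg

section Moving

variable {Ω δ : Type*} [MeasurableSpace Ω] [MeasurableSpace δ] {P : Measure Ω}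
  [IsProbabilityMeasure P] {lam β : ℝ} {X : ℕ → Ω → Plane} {h : ℕ → Ω → ℝ} {C : Ω → δ}
  {a b : δ → Plane}

/-- The received powers have a finite sum: the Laplace transform of the total power tends to `1`
at `0`. -/
lemma IsHomogeneousPPP.ae_totalPower_ne_top (hX : IsHomogeneousPPP P lam X) (hlam : 0 < lam)
    (hβ : 2 < β) (hmeas : ∀ j, Measurable (h j)) (hlaw : ∀ j, P.map (h j) = expMeasure 1)
    (hindep : iIndepFun h P) (hXh : IndepFun (fun ω i => X i ω) (fun ω j => h j ω) P)
    (hC : Measurable C) (hXhC : IndepFun (fun ω => ((fun i => X i ω), fun j => h j ω)) C P)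
    (hb : Measurable b) :
    ∀ᵐ ω ∂P, totalPower β (fun i => X i ω) (fun j => h j ω) (b (C ω)) ≠ ∞ := by
  have hXm : Measurable fun ω i => X i ω := measurable_pi_iff.2 hX.measurable
  have hhm : Measurable fun ω j => h j ω := measurable_pi_iff.2 hmeas
  have hT : Measurable fun p : ((ℕ → Plane) × (ℕ → ℝ)) × δ => totalPower β p.1.1 p.1.2 (b p.2) :=
    measurable_totalPower β (measurable_fst.comp measurable_fst)
      (measurable_snd.comp measurable_fst) (hb.comp measurable_snd)
  have hTω : Measurable fun ω => totalPower β (fun i => X i ω) (fun j => h j ω) (b (C ω)) :=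
    measurable_totalPower β hXm hhm (hb.comp hC)
  set T : Ω → ℝ≥0∞ := fun ω => totalPower β (fun i => X i ω) (fun j => h j ω) (b (C ω))
  have hfin : MeasurableSet {ω | T ω ≠ ∞} := (hTω (measurableSet_singleton ∞)).compl
  have hE : ∀ z : ℝ, 0 < z → ENNReal.ofReal (Real.exp (-(lam * thinningMass β z))) ≤
      P {ω | T ω ≠ ∞} := by
    intro z hz
    have h1 := lintegral_comp_of_indepFun₃ hXm hhm hC hXh hXhC
      (measurable_expNeg.comp (hT.const_mul (ENNReal.ofReal z)))
    simp only [Function.comp_def, hX.laplace_totalPower hlam hβ hmeas hlaw hindep hz,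
      lintegral_const, measure_univ, mul_one] at h1
    rw [← h1, ← lintegral_indicator_one hfin]
    refine lintegral_mono fun ω => ?_
    by_cases hω : T ω = ∞
    · have hω' : totalPower β (fun i => X i ω) (fun j => h j ω) (b (C ω)) = ∞ := hω
      rw [hω', ENNReal.mul_top (by simpa using hz), expNeg_top]
      exact zero_le
    · rw [Set.indicator_of_mem (by exact hω)]
      exact expNeg_le_one _
  have hlim : Tendsto (fun z : ℝ => ENNReal.ofReal (Real.exp (-(lam * thinningMass β z))))
      (𝓝[>] 0) (𝓝 1) := by
    have hs : 0 < 2 / β := div_pos two_pos (by linarith)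
    have h0 : ContinuousAt (fun z : ℝ => Real.exp (-(lam * thinningMass β z))) 0 := by
      have := Real.continuousAt_rpow_const 0 (2 / β) (Or.inr hs.le)
      unfold thinningMass
      fun_prop
    have h1 : Real.exp (-(lam * thinningMass β 0)) = 1 := by
      simp [thinningMass, Real.zero_rpow hs.ne']
    have h2 := ENNReal.tendsto_ofReal (h0.tendsto.mono_left
      (nhdsWithin_le_nhds (s := Set.Ioi 0)))
    simpa [h1] using h2
  have hone : P {ω | T ω ≠ ∞} = 1 := le_antisymm prob_le_one
    (le_of_tendsto hlim (eventually_mem_nhdsWithin.mono fun z hz => hE z hz))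
  exact (mem_ae_iff_prob_eq_one hfin).2 hone

/-- The interference does not vanish: its Laplace transform tends to `0` at `∞`. -/
lemma IsHomogeneousPPP.ae_totalInterference_ne_zero (hX : IsHomogeneousPPP P lam X)
    (hlam : 0 < lam) (hβ : 2 < β) (hmeas : ∀ j, Measurable (h j))
    (hlaw : ∀ j, P.map (h j) = expMeasure 1) (hindep : iIndepFun h P)
    (hXh : IndepFun (fun ω i => X i ω) (fun ω j => h j ω) P) (hC : Measurable C)
    (hXhC : IndepFun (fun ω => ((fun i => X i ω), fun j => h j ω)) C P)
    (ha : Measurable a) (hb : Measurable b) :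
    ∀ᵐ ω ∂P, totalInterference β (fun i => X i ω) (fun j => h j ω) (b (C ω))
      (nearestIndex (fun i => X i ω) (a (C ω))) ≠ 0 := by
  have hXm : Measurable fun ω i => X i ω := measurable_pi_iff.2 hX.measurable
  have hhm : Measurable fun ω j => h j ω := measurable_pi_iff.2 hmeas
  have hI : Measurable fun p : ((ℕ → Plane) × (ℕ → ℝ)) × δ =>
      totalInterference β p.1.1 p.1.2 (b p.2) (nearestIndex p.1.1 (a p.2)) :=
    measurable_totalInterference β (measurable_fst.comp measurable_fst)
      (measurable_snd.comp measurable_fst) (ha.comp measurable_snd) (hb.comp measurable_snd)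
  have hIω : Measurable fun ω => totalInterference β (fun i => X i ω) (fun j => h j ω) (b (C ω))
      (nearestIndex (fun i => X i ω) (a (C ω))) :=
    measurable_totalInterference β hXm hhm (ha.comp hC) (hb.comp hC)
  set I : Ω → ℝ≥0∞ := fun ω => totalInterference β (fun i => X i ω) (fun j => h j ω) (b (C ω))
      (nearestIndex (fun i => X i ω) (a (C ω)))
  have hzero : MeasurableSet {ω | I ω = 0} := hIω (measurableSet_singleton 0)
  have hE : ∀ z : ℝ, 0 < z → P {ω | I ω = 0} ≤
      ENNReal.ofReal (2 * Real.exp (-(lam * thinningMass β z / 2))) := by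
    intro z hz
    have h1 := lintegral_comp_of_indepFun₃ hXm hhm hC hXh hXhC
      (measurable_expNeg.comp (hI.const_mul (ENNReal.ofReal z)))
    simp only [Function.comp_def,
      hX.laplace_totalInterference hlam hmeas hlaw hindep hz] at h1
    calc P {ω | I ω = 0} ≤ ∫⁻ ω, expNeg (ENNReal.ofReal z * I ω) ∂P := by
          rw [← lintegral_indicator_one hzero]
          refine lintegral_mono fun ω => ?_
          by_cases hω : I ω = 0
          · simp [hω]
          · rw [Set.indicator_of_notMem (by exact hω)]
            exact zero_le
      _ = ∫⁻ ω, laplaceBeyond lam β (a (C ω)) (b (C ω)) z ∂P := h1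
      _ ≤ ∫⁻ _, ENNReal.ofReal (2 * Real.exp (-(lam * thinningMass β z / 2))) ∂P :=
          lintegral_mono fun ω => laplaceBeyond_le hlam hβ hz _ _
      _ = _ := by simp
  have hlim : Tendsto
      (fun z : ℝ => ENNReal.ofReal (2 * Real.exp (-(lam * thinningMass β z / 2))))
      atTop (𝓝 0) := by
    have hs : 0 < 2 / β := div_pos two_pos (by linarith)
    have hk : 0 < lam * (Real.pi * Kβ β) / 2 := by
      have := Kβ_pos hβ
      positivity
    have h1 : Tendsto (fun z : ℝ => lam * thinningMass β z / 2) atTop atTop := by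
      refine ((tendsto_rpow_atTop hs).const_mul_atTop hk).congr fun z => ?_
      rw [thinningMass]
      ring
    have h2 := ENNReal.tendsto_ofReal ((Real.tendsto_exp_neg_atTop_nhds_zero.comp h1).const_mul 2)
    simpa using h2
  rw [ae_iff]
  have hset : {ω | ¬I ω ≠ 0} = {ω | I ω = 0} := by simp
  rw [hset]
  refine le_antisymm (ge_of_tendsto hlim ?_) zero_le
  filter_upwards [eventually_gt_atTop 0] with z hz
  exact hE z hz

/-- The expected rate at the random location `b (C ω)` when served by the station nearest to
`a (C ω)`, for `C` independent of the stations and of the fading. -/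
theorem IsHomogeneousPPP.integral_dataRate (hX : IsHomogeneousPPP P lam X) (hlam : 0 < lam)
    (hβ : 2 < β) (σ : ℝ) (hmeas : ∀ j, Measurable (h j))
    (hlaw : ∀ j, P.map (h j) = expMeasure 1) (hindep : iIndepFun h P)
    (hXh : IndepFun (fun ω i => X i ω) (fun ω j => h j ω) P) (hC : Measurable C)
    (hXhC : IndepFun (fun ω => ((fun i => X i ω), fun j => h j ω)) C P)
    (ha : Measurable a) (hb : Measurable b) :
    Integrable (fun ω => dataRate β σ (fun i => X i ω) (fun j => h j ω) (b (C ω))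
        (nearestIndex (fun i => X i ω) (a (C ω)))) P ∧
      ∫ ω, dataRate β σ (fun i => X i ω) (fun j => h j ω) (b (C ω))
        (nearestIndex (fun i => X i ω) (a (C ω))) ∂P =
      ∫ ω, tau lam β σ ‖b (C ω) - a (C ω)‖ ∂P := by
  have hXm : Measurable fun ω i => X i ω := measurable_pi_iff.2 hX.measurable
  have hhm : Measurable fun ω j => h j ω := measurable_pi_iff.2 hmeas
  set ξ : Ω → ℝ := fun ω => dataRate β σ (fun i => X i ω) (fun j => h j ω) (b (C ω))
    (nearestIndex (fun i => X i ω) (a (C ω)))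
  set M : Ω → ℝ≥0∞ := fun ω =>
    mixedRate β σ (fun i => X i ω) (fun j => h j ω) (a (C ω)) (b (C ω))
  have hM : Measurable M := measurable_mixedRate β σ hXm hhm (ha.comp hC) (hb.comp hC)
  have hnonneg : 0 ≤ᵐ[P] ξ := by
    filter_upwards [ae_fading_nonneg hmeas hlaw] with ω hω
    exact dataRate_nonneg hω _
  have heq : (fun ω => ENNReal.ofReal (ξ ω)) =ᵐ[P] M := by
    filter_upwards [ae_fading_nonneg hmeas hlaw,
      hX.ae_totalPower_ne_top hlam hβ hmeas hlaw hindep hXh hC hXhC hb,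
      hX.ae_totalInterference_ne_zero hlam hβ hmeas hlaw hindep hXh hC hXhC ha hb] with ω h1 h2 h3
    exact ofReal_dataRate h1 h2 h3
  have hξm : AEStronglyMeasurable ξ P := by
    refine hM.ennreal_toReal.aestronglyMeasurable.congr ?_
    filter_upwards [heq, hnonneg] with ω h1 h2
    rw [← h1, ENNReal.toReal_ofReal h2]
  have hlint : ∫⁻ ω, ENNReal.ofReal (ξ ω) ∂P =
      ∫⁻ ω, ENNReal.ofReal (tau lam β σ ‖b (C ω) - a (C ω)‖) ∂P := by
    rw [lintegral_congr_ae heq]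
    have hF : Measurable fun p : ((ℕ → Plane) × (ℕ → ℝ)) × δ =>
        mixedRate β σ p.1.1 p.1.2 (a p.2) (b p.2) :=
      measurable_mixedRate β σ (measurable_fst.comp measurable_fst)
        (measurable_snd.comp measurable_fst) (ha.comp measurable_snd) (hb.comp measurable_snd)
    have h1 := lintegral_comp_of_indepFun₃ hXm hhm hC hXh hXhC hF
    simp only [hX.lintegral_mixedRate hlam hβ σ hmeas hlaw hindep] at h1
    exact h1
  have hτm : AEStronglyMeasurable (fun ω => tau lam β σ ‖b (C ω) - a (C ω)‖) P := by
    obtain ⟨g, hg, hgτ⟩ := exists_measurable_tau σ hlam hβ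
    refine (hg.comp ((hb.comp hC).sub (ha.comp hC)).norm).aestronglyMeasurable.congr
      (ae_of_all _ fun ω => hgτ _ (norm_nonneg _))
  refine ⟨(lintegral_ofReal_ne_top_iff_integrable hξm hnonneg).1 ?_, ?_⟩
  · rw [hlint]
    refine ((lintegral_mono fun ω => ENNReal.ofReal_le_ofReal
      (tau_le σ hlam hβ (norm_nonneg (b (C ω) - a (C ω))))).trans_lt ?_).ne
    simp
  · rw [integral_eq_lintegral_of_nonneg_ae hnonneg hξm, hlint,
      integral_eq_lintegral_of_nonneg_ae (ae_of_all _ fun ω =>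
        tau_nonneg σ hlam hβ (norm_nonneg _)) hτm]

end Moving

/-! ### The speed distribution and the long-run mean -/

lemma integrableOn_tau_comp {lam β : ℝ} (σ : ℝ) (hlam : 0 < lam) (hβ : 2 < β) {c : ℝ}
    (hc : 0 ≤ c) (ν : Measure ℝ) [IsFiniteMeasure ν] :
    IntegrableOn (fun v : ℝ => tau lam β σ (c * v)) (Set.Ici 0) ν := by
  obtain ⟨g, hg, hgτ⟩ := exists_measurable_tau σ hlam hβ
  have hmeas : AEStronglyMeasurable (fun v : ℝ => tau lam β σ (c * v))
      (ν.restrict (Set.Ici 0)) :=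
    (hg.comp (measurable_const_mul c)).aestronglyMeasurable.congr
      (ae_restrict_of_forall_mem measurableSet_Ici
        fun v (hv : 0 ≤ v) => hgτ _ (mul_nonneg hc hv))
  refine (integrable_const (∫ z in Set.Ioi 0, tauBound lam β z)).mono' hmeas
    (ae_restrict_of_forall_mem measurableSet_Ici fun v (hv : 0 ≤ v) => ?_)
  rw [Real.norm_of_nonneg (tau_nonneg σ hlam hβ (mul_nonneg hc hv))]
  exact tau_le σ hlam hβ (mul_nonneg hc hv)

lemma setIntegral_tau_map {Ω : Type*} [MeasurableSpace Ω] {P : Measure Ω} {lam β : ℝ} (σ : ℝ)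
    (hlam : 0 < lam) (hβ : 2 < β) {c : ℝ} (hc : 0 ≤ c) {V : Ω → ℝ} (hV : Measurable V)
    (hV0 : ∀ ω, 0 ≤ V ω) :
    ∫ v in Set.Ici 0, tau lam β σ (c * v) ∂P.map V = ∫ ω, tau lam β σ (c * V ω) ∂P := by
  obtain ⟨g, hg, hgτ⟩ := exists_measurable_tau σ hlam hβ
  have hgc : Measurable fun v => g (c * v) := hg.comp (measurable_const_mul c)
  have hpre : V ⁻¹' Set.Ici 0 = Set.univ := Set.eq_univ_of_forall hV0
  rw [setIntegral_congr_fun measurableSet_Ici fun v (hv : 0 ≤ v) =>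
      (hgτ (c * v) (mul_nonneg hc hv)).symm,
    setIntegral_map measurableSet_Ici hgc.aestronglyMeasurable hV.aemeasurable, hpre,
    setIntegral_univ]
  exact integral_congr_ae (ae_of_all _ fun ω => hgτ _ (mul_nonneg hc (hV0 ω)))

end CellularNetwork

open CellularNetwork
theorem theorem1 {Ω : Type*} [MeasurableSpace Ω] (P : Measure Ω) [IsProbabilityMeasure P]
    (lam β σ : ℝ) (hlam : 0 < lam) (hβ : 2 < β) (s : ℕ) (hs : 1 ≤ s)
    -- base stations: a homogeneous Poisson point process
    (X : ℕ → Ω → Plane) (hX : IsHomogeneousPPP P lam X)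
    -- Rayleigh fading: i.i.d. unit-mean exponential received power gains
    (H : ℕ → ℕ → Ω → ℝ) (hHmeas : ∀ i t, Measurable (H i t))
    (hHlaw : ∀ i t, P.map (H i t) = expMeasure 1)
    (hHindep : iIndepFun (fun p : ℕ × ℕ => H p.1 p.2) P)
    -- mobility: i.i.d. displacements over the successive cycles
    (Y : ℕ → Ω → Plane) (hYmeas : ∀ k, Measurable (Y k))
    (hYident : ∀ k, IdentDistrib (Y k) (Y 0) P P) (hYindep : iIndepFun Y P)
    -- base stations, fading and mobility are mutually independent
    (hXH : IndepFun (fun ω i => X i ω) (fun ω i t => H i t ω) P)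
    (hXHY : IndepFun (fun ω => ((fun i => X i ω), (fun i t => H i t ω))) (fun ω k => Y k ω) P) :
    -- the interference is almost surely finite, and the expected rate in each slot is finite
    (∀ t : ℕ, ∀ᵐ ω ∂P, Summable fun j : ℕ =>
      receivedPower β (fun i => X i ω) (fun i => H i t ω) (position s (fun k => Y k ω) t) j) ∧
    (∀ t : ℕ, Integrable (skippingRate β σ s X H Y t) P) ∧
    -- the integrals in the formula converge
    (∀ z u : ℝ, 0 < z → 0 ≤ u → IntegrableOn (muIntegrand lam β z u) (Set.Ioi 0)) ∧
    (∀ u : ℝ, 0 ≤ u → IntegrableOn (tauIntegrand lam β σ u) (Set.Ioi 0)) ∧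
    (∀ t ∈ Finset.range s, IntegrableOn (fun v : ℝ => tau lam β σ ((t : ℝ) * v)) (Set.Ici 0)
      (P.map fun ω => ‖Y 0 ω‖ / (s : ℝ))) ∧
    -- the long-run expected downlink data rate exists and is given by the formula
    Tendsto (fun m : ℕ =>
        1 / (m : ℝ) * ∫ ω, ∑ t ∈ Finset.range m, skippingRate β σ s X H Y t ω ∂P) atTop
      (𝓝 (1 / (s : ℝ) * ∑ t ∈ Finset.range s,
        ∫ v in Set.Ici (0 : ℝ), tau lam β σ ((t : ℝ) * v) ∂(P.map fun ω => ‖Y 0 ω‖ / (s : ℝ)))) := by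

  have hslot : ∀ t : ℕ, (∀ i, Measurable (H i t)) ∧ (∀ i, P.map (H i t) = expMeasure 1) ∧
      iIndepFun (fun i => H i t) P ∧
      IndepFun (fun ω i => X i ω) (fun ω i => H i t ω) P ∧
      IndepFun (fun ω => ((fun i => X i ω), fun i => H i t ω)) (fun ω k => Y k ω) P := by
    intro t
    have hproj : Measurable fun (y : ℕ → ℕ → ℝ) (i : ℕ) => y i t := by fun_prop
    refine ⟨fun i => hHmeas i t, fun i => hHlaw i t, ?_, ?_, ?_⟩
    · exact hHindep.precomp (g := fun i => (i, t)) fun i j hij => (Prod.mk.inj hij).1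
    · exact hXH.comp measurable_id hproj
    · exact hXHY.comp (φ := fun p : (ℕ → Plane) × (ℕ → ℕ → ℝ) => (p.1, fun i => p.2 i t))
        (measurable_fst.prodMk (hproj.comp measurable_snd)) measurable_id
  have hYm : Measurable fun ω k => Y k ω := measurable_pi_iff.2 hYmeas
  have hpos : ∀ t, Measurable fun y : ℕ → Plane => position s y t := fun t =>
    measurable_position measurable_id s t
  have hrate : ∀ t, Integrable (skippingRate β σ s X H Y t) P ∧
      ∫ ω, skippingRate β σ s X H Y t ω ∂P =
        ∫ ω, tau lam β σ ((t % s : ℕ) * (‖Y 0 ω‖ / s)) ∂P := by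
    intro t
    obtain ⟨h1, h2, h3, h4, h5⟩ := hslot t
    obtain ⟨hint, hval⟩ := hX.integral_dataRate hlam hβ σ h1 h2 h3 h4 hYm h5
      (hpos (s * (t / s))) (hpos t)
    refine ⟨hint, hval.trans ?_⟩
    obtain ⟨g, hg, hgτ⟩ := exists_measurable_tau σ hlam hβ
    have hnn : ∀ y : Plane, 0 ≤ ((t % s : ℕ) : ℝ) * (‖y‖ / s) := fun y => by positivity
    have hid := ((hYident (t / s)).comp (u := fun y : Plane =>
      g (((t % s : ℕ) : ℝ) * (‖y‖ / s))) (hg.comp (by fun_prop))).integral_eq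
    simp only [Function.comp_def, hgτ _ (hnn _)] at hid
    rw [← hid]
    refine integral_congr_ae (ae_of_all _ fun ω => ?_)
    simp only [norm_position_sub hs]
  have hV : Measurable fun ω => ‖Y 0 ω‖ / (s : ℝ) := (hYmeas 0).norm.div_const _
  have := Measure.isProbabilityMeasure_map (μ := P) hV.aemeasurable
  refine ⟨fun t => ?_, fun t => (hrate t).1, fun z u hz hu => integrableOn_muIntegrand hlam hβ hz hu,
    fun u hu => integrableOn_tauIntegrand σ hlam hβ hu,
    fun t _ => integrableOn_tau_comp σ hlam hβ t.cast_nonneg _, ?_⟩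
  · obtain ⟨h1, h2, h3, h4, h5⟩ := hslot t
    filter_upwards [ae_fading_nonneg h1 h2,
      hX.ae_totalPower_ne_top hlam hβ h1 h2 h3 h4 hYm h5 (hpos t)] with ω hω hfin
    exact summable_receivedPower hω hfin
  · simp_rw [integral_finsetSum _ fun t _ => (hrate t).1, fun t => (hrate t).2,
      fun t : ℕ => setIntegral_tau_map (P := P) σ hlam hβ t.cast_nonneg hV
        fun ω => div_nonneg (norm_nonneg (Y 0 ω)) s.cast_nonneg]
    exact tendsto_mean_periodic
      (fun t : ℕ => ∫ ω, tau lam β σ ((t : ℝ) * (‖Y 0 ω‖ / (s : ℝ))) ∂P) hs
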